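/- Let $n\ge 1$ and $m\ge 0$ be integers. Let $\mathcal T$ be an additive category with an $n$-suspension functor $\Sigma_n$ (an autoequivalence of $\mathcal T$) and an $(n+2)$-angulation in the sense of Geiss, Keller and Oppermann, that is, a class of sequences $t^0\to t^1\to\cdots\to t^{n+1}\to\Sigma_n t^0$, called $(n+2)$-angles, satisfying the axioms (F1)–(F4) of an $(n+2)$-angulated category. Let $\{\mathfrak a_j\}_{j\in\mathbb Z}$ be additive subcategories of $\mathcal T$ (full, closed under isomorphisms and finite direct sums) such that (a) $\operatorname{Hom}_{\mathcal T}(\mathfrak a_i,\mathfrak a_j)=0$ for $j\notin\{i,i+1\}$; (b) every $t\in\mathcal T$ is isomorphic to a finite direct sum $a_s\oplus a_{s-1}\oplus\cdots\oplus a_i$ with $a_j\in\mathfrak a_j$; (c) $\mathfrak a_j=\Sigma_n^j\mathfrak a_0$ for all $j\in\mathbb Z$ (as subcategories closed under isomorphisms). For integers $i\le j$ let $\mathcal T[i,j]=\operatorname{add}(\mathfrak a_i,\mathfrak a_{i+1},\ldots,\mathfrak a_j)$ be the full subcategory of all direct summands of finite direct sums of objects of $\mathfrak a_i,\ldots,\mathfrak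 a_j$. Assume further that idempotents split in $\mathfrak a_0$, and that $\mathcal T[0,m+1]$ is closed under $n$-extensions: for all $t^0,t^{n+1}\in\mathcal T[0,m+1]$ and every morphism $\delta:t^{n+1}\to\Sigma_n t^0$ there is an $(n+2)$-angle $$t^0\to t^1\to\cdots\to t^n\to t^{n+1}\xrightarrow{\ \delta\ }\Sigma_n t^0$$ with $t^1,\ldots,t^n\in\mathcal T[0,m+1]$. Then $\mathcal T[0,m]$ is a $d$-abelian category with $d=(n+2)(m+1)-2$. That is: $\mathcal T[0,m]$ is additive; its idempotents split; every morphism has a $d$-kernel and a $d$-cokernel; for every monomorphism $f_0$ of $\mathcal T[0,m]$ and every $d$-cokernel $(f_1,\ldots,f_d)$ of $f_0$ in $\mathcal T[0,m]$ the sequence $(f_0,f_1,\ldots,f_d)$ is $d$-exact; and dually, for every epimorphism $g_d$ and every $d$-kernel $(g_0,\ldots,g_{d-1})$ of $g_d$ the sequence $(g_0,\ldots,g_d)$ is $d$-exact. Here $(f_1,\ldots,f_d)$, $X_1\to\cdots\to X_{d+1}$, is a $d$-cokernel of $f_0:X_0\to X_1$ if $0\to\operatorname{Hom}(X_{d+1},Y)\to\cdots\to\operatorname{Hom}(X_1,Y)\to\operatorname{Hom}(X_0,Y)$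 is exact for every object $Y$; $d$-kernels are defined dually; and $(f_0,\ldots,f_d)$ is $d$-exact if $(f_1,\ldots,f_d)$ is a $d$-cokernel of $f_0$ and $(f_0,\ldots,f_{d-1})$ is a $d$-kernel of $f_d$. -/

import Mathlib

universe v u

open CategoryTheory CategoryTheory.Limits

noncomputable section

attribute [local instance] hasBinaryBiproducts_of_finite_biproducts

namespace HigherAngle

/-! ### `d`-abelian categories -/

section DAbelian

variable {C : Type u} [Category.{v} C] [Preadditive C] {d : ℕ}

/-- For a sequence `X₀ ⟶ X₁ ⟶ ⋯ ⟶ X_{d+1}`, the part `X₁ ⟶ ⋯ ⟶ X_{d+1}` is a `d`-cokernel of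
`X₀ ⟶ X₁`: for every object `Y` the sequence of abelian groups
`0 ⟶ Hom(X_{d+1}, Y) ⟶ Hom(X_d, Y) ⟶ ⋯ ⟶ Hom(X₁, Y) ⟶ Hom(X₀, Y)` is exact. -/
def IsDCokernel (X : ComposableArrows C (d + 1)) : Prop :=
  ∀ Y : C,
    Function.Injective (fun h : X.obj' (d + 1) ⟶ Y => X.map' d (d + 1) ≫ h) ∧
    ∀ (i : ℕ) (_ : i < d),
      Function.Exact (fun h : X.obj' (i + 2) ⟶ Y => X.map' (i + 1) (i + 2) ≫ h)
        (fun h : X.obj' (i + 1) ⟶ Y => X.map' i (i + 1) ≫ h)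

/-- For a sequence `X₀ ⟶ X₁ ⟶ ⋯ ⟶ X_{d+1}`, the part `X₀ ⟶ ⋯ ⟶ X_d` is a `d`-kernel of
`X_d ⟶ X_{d+1}`: for every object `Y` the sequence of abelian groups
`0 ⟶ Hom(Y, X₀) ⟶ Hom(Y, X₁) ⟶ ⋯ ⟶ Hom(Y, X_d) ⟶ Hom(Y, X_{d+1})` is exact. -/
def IsDKernel (X : ComposableArrows C (d + 1)) : Prop :=
  ∀ Y : C,
    Function.Injective (fun h : Y ⟶ X.obj' 0 => h ≫ X.map' 0 1) ∧
    ∀ (i : ℕ) (_ : i < d),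
      Function.Exact (fun h : Y ⟶ X.obj' i => h ≫ X.map' i (i + 1))
        (fun h : Y ⟶ X.obj' (i + 1) => h ≫ X.map' (i + 1) (i + 2))

/-- A sequence `X₀ ⟶ X₁ ⟶ ⋯ ⟶ X_{d+1}` is `d`-exact. -/
def IsDExact (X : ComposableArrows C (d + 1)) : Prop :=
  IsDCokernel X ∧ IsDKernel X

end DAbelian

/-- A `d`-abelian category, for a positive integer `d`. -/
structure IsDAbelian (C : Type u) [Category.{v} C] [Preadditive C] (d : ℕ) : Prop where
  /-- `d` is positive -/
  pos : 0 < d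
  /-- the category is additive -/
  hasFiniteBiproducts : HasFiniteBiproducts C
  /-- idempotents split -/
  isIdempotentComplete : IsIdempotentComplete C
  /-- every morphism has a `d`-kernel -/
  exists_dKernel : ∀ {A B : C} (f : A ⟶ B), ∃ X : ComposableArrows C (d + 1),
    Nonempty (Arrow.mk (X.map' d (d + 1)) ≅ Arrow.mk f) ∧ IsDKernel X
  /-- every morphism has a `d`-cokernel -/
  exists_dCokernel : ∀ {A B : C} (f : A ⟶ B), ∃ X : ComposableArrows C (d + 1),
    Nonempty (Arrow.mk (X.map' 0 1) ≅ Arrow.mk f) ∧ IsDCokernel X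
  /-- a monomorphism together with any `d`-cokernel of it is a `d`-exact sequence -/
  dExact_of_mono : ∀ X : ComposableArrows C (d + 1),
    Mono (X.map' 0 1) → IsDCokernel X → IsDExact X
  /-- an epimorphism together with any `d`-kernel of it is a `d`-exact sequence -/
  dExact_of_epi : ∀ X : ComposableArrows C (d + 1),
    Epi (X.map' d (d + 1)) → IsDKernel X → IsDExact X

/-! ### `(n+2)`-angulated categories -/

section Angulated

variable {T : Type u} [Category.{v} T]

/-- An `(n+2)`-`S`-sequence `X₀ ⟶ X₁ ⟶ ⋯ ⟶ X_{n+1} ⟶ S X₀`. -/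
structure SSeq (S : T ≌ T) (n : ℕ) where
  /-- the part `X₀ ⟶ X₁ ⟶ ⋯ ⟶ X_{n+1}` -/
  arrows : ComposableArrows T (n + 1)
  /-- the last morphism `X_{n+1} ⟶ S X₀` -/
  conn : arrows.obj' (n + 1) ⟶ S.functor.obj (arrows.obj' 0)

namespace SSeq

variable {S : T ≌ T} {n : ℕ}

/-- The `i`-th object of a sequence. -/
abbrev obj (X : SSeq S n) (i : ℕ) (hi : i ≤ n + 1 := by lia) : T :=
  X.arrows.obj' i hi

/-- The `i`-th morphism `X_i ⟶ X_{i+1}` of a sequence, for `i ≤ n`. -/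
abbrev d (X : SSeq S n) (i : ℕ) (hi : i ≤ n := by lia) : X.obj i ⟶ X.obj (i + 1) :=
  X.arrows.map' i (i + 1)

/-- A morphism of sequences: `φ_i : X_i ⟶ Y_i` for `0 ≤ i ≤ n + 1` such that all squares
commute, the last vertical morphism being `S φ₀`. -/
structure Hom (X Y : SSeq S n) where
  /-- the morphisms `φ_i` -/
  app : X.arrows ⟶ Y.arrows
  /-- the last square commutes -/
  comm : X.conn ≫ S.functor.map (ComposableArrows.app' app 0) =
    ComposableArrows.app' app (n + 1) ≫ Y.conn

/-- The component `φ_i : X_i ⟶ Y_i` of a morphism of sequences. -/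
abbrev Hom.φ {X Y : SSeq S n} (f : Hom X Y) (i : ℕ) (hi : i ≤ n + 1 := by lia) :
    X.obj i ⟶ Y.obj i :=
  ComposableArrows.app' f.app i hi

/-- `Y` is (isomorphic to) the left rotation
`X₁ ⟶ X₂ ⟶ ⋯ ⟶ X_{n+1} ⟶ S X₀ ⟶ S X₁` of `X`, with last morphism `(-1)^(n+2) S d₀`. -/
def IsRotation [Preadditive T] (X Y : SSeq S n) : Prop :=
  ∃ (e : ∀ (i : ℕ) (_ : i ≤ n), Y.obj i ≅ X.obj (i + 1))
    (e' : Y.obj (n + 1) ≅ S.functor.obj (X.obj 0)),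
    (∀ (i : ℕ) (_ : i < n),
      Y.d i ≫ (e (i + 1) (by lia)).hom = (e i (by lia)).hom ≫ X.d (i + 1)) ∧
    Y.d n ≫ e'.hom = (e n le_rfl).hom ≫ X.conn ∧
    Y.conn ≫ S.functor.map (e 0 (by lia)).hom =
      e'.hom ≫ ((-1 : ℤ) ^ (n + 2) • S.functor.map (X.d 0))

/-- `X` is (isomorphic to) a trivial sequence `A = A ⟶ 0 ⟶ ⋯ ⟶ 0 ⟶ S A`. -/
def IsTrivial (X : SSeq S n) : Prop :=
  IsIso (X.d 0) ∧ ∀ (i : ℕ) (_ : 2 ≤ i) (_ : i ≤ n + 1), IsZero (X.obj i)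

variable [Preadditive T] [HasFiniteBiproducts T]

/-- The direct sum of two sequences. -/
def directSum (X Y : SSeq S n) : SSeq S n where
  arrows :=
    { obj := fun i => X.arrows.obj i ⊞ Y.arrows.obj i
      map := fun f => biprod.map (X.arrows.map f) (Y.arrows.map f) }
  conn := biprod.desc (X.conn ≫ S.functor.map biprod.inl) (Y.conn ≫ S.functor.map biprod.inr)

/-- `Z` is (isomorphic to) the mapping cone
`X₁ ⊞ Y₀ ⟶ X₂ ⊞ Y₁ ⟶ ⋯ ⟶ X_{n+1} ⊞ Y_n ⟶ S X₀ ⊞ Y_{n+1} ⟶ S X₁ ⊞ S Y₀`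
of the morphism `f : X ⟶ Y`. With `α`, `β` the morphisms of `X`, `Y` and `φ` the components
of `f`, the morphisms of the cone have the components `-α_{i+1}`, `φ_{i+1}`, `0`, `β_i`, where
`α_{n+2} = S α₀` and `φ_{n+2} = S φ₀`. The last object is written `S (X₁ ⊞ Y₀)`. -/
def IsCone {X Y : SSeq S n} (f : Hom X Y) (Z : SSeq S n) : Prop :=
  ∃ (e : ∀ (i : ℕ) (_ : i ≤ n), Z.obj i ≅ X.obj (i + 1) ⊞ Y.obj i)
    (e' : Z.obj (n + 1) ≅ S.functor.obj (X.obj 0) ⊞ Y.obj (n + 1)),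
    (∀ (i : ℕ) (_ : i < n),
      Z.d i ≫ (e (i + 1) (by lia)).hom = (e i (by lia)).hom ≫
        Biprod.ofComponents (-X.d (i + 1)) (f.φ (i + 1)) 0 (Y.d i)) ∧
    Z.d n ≫ e'.hom = (e n le_rfl).hom ≫
      Biprod.ofComponents (-X.conn) (f.φ (n + 1)) 0 (Y.d n) ∧
    Z.conn ≫ S.functor.map (e 0 (by lia)).hom = e'.hom ≫
      biprod.desc
        (-S.functor.map (X.d 0) ≫ S.functor.map biprod.inl +
          S.functor.map (f.φ 0) ≫ S.functor.map biprod.inr)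
        (Y.conn ≫ S.functor.map biprod.inr)

end SSeq

/-- An `(n+2)`-angulation of the additive category `T` with `n`-suspension `S`: a class of
`(n+2)`-`S`-sequences, the `(n+2)`-angles, that satisfies the axioms of Geiss, Keller and
Oppermann. -/
structure Angulation [Preadditive T] [HasFiniteBiproducts T] (S : T ≌ T) (n : ℕ) where
  /-- `X` is an `(n+2)`-angle -/
  IsAngle : SSeq S n → Prop
  /-- closure under isomorphisms -/
  of_iso : ∀ {X Y : SSeq S n} (f : SSeq.Hom X Y), IsIso f.app → IsAngle X → IsAngle Y
  /-- closure under direct sums and direct summands -/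
  directSum_iff : ∀ X Y : SSeq S n, IsAngle (X.directSum Y) ↔ IsAngle X ∧ IsAngle Y
  /-- trivial sequences are angles -/
  of_isTrivial : ∀ X : SSeq S n, X.IsTrivial → IsAngle X
  /-- every morphism is the first morphism of an angle -/
  exists_angle : ∀ {A B : T} (f : A ⟶ B), ∃ X : SSeq S n, IsAngle X ∧
    Nonempty (Arrow.mk (X.d 0) ≅ Arrow.mk f)
  /-- a sequence is an angle if and only if its left rotation is -/
  rotation_iff : ∀ X Y : SSeq S n, X.IsRotation Y → (IsAngle X ↔ IsAngle Y)
  /-- a commutative square between the first morphisms of two angles extends to a morphism of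
  angles, and the extension can be chosen such that its mapping cone is an angle -/
  exists_hom_cone : ∀ X Y : SSeq S n, IsAngle X → IsAngle Y →
    ∀ (φ₀ : X.obj 0 ⟶ Y.obj 0) (φ₁ : X.obj 1 ⟶ Y.obj 1), X.d 0 ≫ φ₁ = φ₀ ≫ Y.d 0 →
    ∃ f : SSeq.Hom X Y, f.φ 0 = φ₀ ∧ f.φ 1 = φ₁ ∧
      ∃ Z : SSeq S n, SSeq.IsCone f Z ∧ IsAngle Z

end Angulated

/-! ### Truncated subcategories -/

section Truncated

variable {T : Type u} [Category.{v} T] [Preadditive T] [HasFiniteBiproducts T]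

/-- `P` is an additive (full) subcategory: it is closed under isomorphisms and finite direct
sums. -/
structure IsAdditiveSubcategory (P : ObjectProperty T) : Prop where
  closedUnderIso : P.IsClosedUnderIsomorphisms
  containsZero : P.ContainsZero
  biprod : ∀ A B : T, P A → P B → P (A ⊞ B)

/-- `add P`: the direct summands of finite direct sums of objects of `P`. -/
def add (P : ObjectProperty T) : ObjectProperty T := fun t =>
  ∃ (t' : T) (k : ℕ) (x : Fin k → T), (∀ l, P (x l)) ∧ Nonempty (t ⊞ t' ≅ ⨁ x)

/-- The truncated subcategory `T[i, j] = add (a_i, a_{i+1}, …, a_j)`. -/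
def truncated (a : ℤ → ObjectProperty T) (i j : ℤ) : ObjectProperty T :=
  add fun t => ∃ r : ℤ, i ≤ r ∧ r ≤ j ∧ a r t

/-- `P` is closed under `n`-extensions: for all `A`, `B` in `P`, every morphism `δ : B ⟶ S A` is
the last morphism of an `(n+2)`-angle `A ⟶ X₁ ⟶ ⋯ ⟶ X_n ⟶ B ⟶ S A` with `X₁, …, X_n` in `P`. -/
def IsClosedUnderNExtensions {S : T ≌ T} {n : ℕ} (𝒜 : Angulation S n)
    (P : ObjectProperty T) : Prop :=
  ∀ (A B : T) (δ : B ⟶ S.functor.obj A), P A → P B →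
    ∃ (X : SSeq S n) (e₀ : X.obj 0 ≅ A) (e₁ : X.obj (n + 1) ≅ B),
      𝒜.IsAngle X ∧ X.conn ≫ S.functor.map e₀.hom = e₁.hom ≫ δ ∧
      ∀ (i : ℕ) (_ : 1 ≤ i) (_ : i ≤ n), P (X.obj i)

end Truncated

end HigherAngle

end

noncomputable section

attribute [local instance] hasBinaryBiproducts_of_finite_biproducts

namespace HigherAngle

/-! ### `d`-kernels and `d`-cokernels relative to a class of test objects -/

/-! Complete `f : A ⟶ B` in `T[0,m]` to an angle with terms in degrees `0, …, m + 1` and rotate it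
forever to the right. The first morphisms of the rotations form a complex that is exact under
covariant and contravariant `Hom`, and every `n + 2` rotations suspend it once. So the term at
position `k` lies in degrees at least `k / (n + 2)`, and at position `d + 2 = (n + 2) * (m + 1)`
nothing of degree at most `m` is left. Now delete from each term the summands of degree greater than
`m`. They have no morphisms to `T[0,m]`, so `Hom` into `T[0,m]` does not notice, and what remains up
to position `d + 1` is a `d`-cokernel of `f` (`exists_isRightExtension`,
`IsRightExtension.exists_isDCokernelOn`).

`Hom` out of `T[0,m]` does notice the deletion. The deleted summands form a subcomplex. If `f` is
monic in `T[0,m]`, then the map at position `d + 2`, which is `f` suspended `m + 1` times, is monic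
against degrees greater than `m`; hence the map before it vanishes on the deleted part. Descending
from there, the deleted complex contracts, and removing it preserves exactness: the truncation is
also a `d`-kernel. Any other `d`-cokernel of `f` is homotopy equivalent to this one and inherits the
property (`IsDCokernelOn.isDKernelOn_of_iso`).

For `d`-kernels and epimorphisms one rotates to the left and deletes the negative degrees; read in
the opposite category, this is an instance of the same truncation lemma. Degrees are controlled by
`Supp`, a condition that passes to retracts and makes uniqueness of decompositions unnecessary.
Idempotents split because they are triangular for the grading (`IdempotentsSplit.of_isSumOf`). -/

lemma exists_seq {α : ℕ → Type*} (r : ∀ n, α n → α (n + 1) → Prop) (a₀ : α 0) (a₁ : α 1)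
    (h₀ : r 0 a₀ a₁) (step : ∀ n a b, r n a b → ∃ c, r (n + 1) b c) :
    ∃ s : ∀ n, α n, s 0 = a₀ ∧ s 1 = a₁ ∧ ∀ n, r n (s n) (s (n + 1)) := by
  choose c hc using step
  -- The recursion runs on related pairs, because each choice needs the relation between the two
  -- preceding terms.
  let st : ∀ n, {p : α n × α (n + 1) // r n p.1 p.2} := fun n =>
    Nat.rec ⟨(a₀, a₁), h₀⟩ (fun n p => ⟨(p.1.2, c n p.1.1 p.1.2 p.2), hc n _ _ p.2⟩) n
  exact ⟨fun n => (st n).1.1, rfl, rfl, fun n => (st n).2⟩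

section Relative

variable {T : Type u} [Category.{v} T] [Preadditive T] {d : ℕ}

/-- `d`-cokernels with respect to test objects in `C`. -/
def IsDCokernelOn (C : ObjectProperty T) (X : ComposableArrows T (d + 1)) : Prop :=
  ∀ Y : T, C Y →
    Function.Injective (fun h : X.obj' (d + 1) ⟶ Y => X.map' d (d + 1) ≫ h) ∧
    ∀ (i : ℕ) (_ : i < d),
      Function.Exact (fun h : X.obj' (i + 2) ⟶ Y => X.map' (i + 1) (i + 2) ≫ h)
        (fun h : X.obj' (i + 1) ⟶ Y => X.map' i (i + 1) ≫ h)

/-- `d`-kernels with respect to test objects in `C`. -/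
def IsDKernelOn (C : ObjectProperty T) (X : ComposableArrows T (d + 1)) : Prop :=
  ∀ Y : T, C Y →
    Function.Injective (fun h : Y ⟶ X.obj' 0 => h ≫ X.map' 0 1) ∧
    ∀ (i : ℕ) (_ : i < d),
      Function.Exact (fun h : Y ⟶ X.obj' i => h ≫ X.map' i (i + 1))
        (fun h : Y ⟶ X.obj' (i + 1) => h ≫ X.map' (i + 1) (i + 2))

/-- The sequence of objects and morphisms of `T` given by the opposite sequence. -/
def opSeq {N : ℕ} (X : ComposableArrows T N) : ComposableArrows Tᵒᵖ N where
  obj i := Opposite.op (X.obj i.rev)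
  map f := (X.map (homOfLE (Fin.rev_le_rev.2 (leOfHom f)))).op
  map_id _ := congrArg Quiver.Hom.op (X.map_id _)
  map_comp f g := congrArg Quiver.Hom.op
    (X.map_comp (homOfLE (Fin.rev_le_rev.2 (leOfHom g)))
      (homOfLE (Fin.rev_le_rev.2 (leOfHom f))))

/-- The sequence of objects and morphisms of `T` given by a sequence in the opposite category. -/
def unopSeq {N : ℕ} (X : ComposableArrows Tᵒᵖ N) : ComposableArrows T N where
  obj i := (X.obj i.rev).unop
  map f := (X.map (homOfLE (Fin.rev_le_rev.2 (leOfHom f)))).unop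
  map_id _ := congrArg Quiver.Hom.unop (X.map_id _)
  map_comp f g := congrArg Quiver.Hom.unop
    (X.map_comp (homOfLE (Fin.rev_le_rev.2 (leOfHom g)))
      (homOfLE (Fin.rev_le_rev.2 (leOfHom f))))

variable {C : ObjectProperty T}

/-- The indices are variables tied by equations because reversing a sequence produces indices such
as `d + 1 + 1 - (i + 1)`, which agree with the expected ones only propositionally. -/
lemma IsDCokernelOn.eq_zero {X : ComposableArrows T (d + 1)} (hX : IsDCokernelOn C X)
    {Y : T} (hY : C Y) (i j : ℕ) (hi : i = d) (hj : j = d + 1) (h : X.obj' j ⟶ Y)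
    (w : X.map' i j ≫ h = 0) : h = 0 := by
  subst hi hj
  exact (hX Y hY).1 (by simpa using w)

lemma IsDCokernelOn.exact {X : ComposableArrows T (d + 1)} (hX : IsDCokernelOn C X)
    {Y : T} (hY : C Y) (i j k : ℕ) (hij : i + 1 = j) (hjk : j + 1 = k) (hk : k ≤ d + 1) :
    Function.Exact (fun h : X.obj' k ⟶ Y => X.map' j k ≫ h)
        (fun h : X.obj' j ⟶ Y => X.map' i j ≫ h) := by
  subst hij hjk
  exact (hX Y hY).2 i (by lia)

lemma IsDKernelOn.eq_zero {X : ComposableArrows T (d + 1)} (hX : IsDKernelOn C X)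
    {Y : T} (hY : C Y) (i j : ℕ) (hi : i = 0) (hj : j = 1) (h : Y ⟶ X.obj' i)
    (w : h ≫ X.map' i j = 0) : h = 0 := by
  subst hi hj
  exact (hX Y hY).1 (by simp only [zero_comp]; exact w)

lemma IsDKernelOn.exact {X : ComposableArrows T (d + 1)} (hX : IsDKernelOn C X)
    {Y : T} (hY : C Y) (i j k : ℕ) (hij : i + 1 = j) (hjk : j + 1 = k) (hk : k ≤ d + 1) :
    Function.Exact (fun h : Y ⟶ X.obj' i => h ≫ X.map' i j)
        (fun h : Y ⟶ X.obj' j => h ≫ X.map' j k) := by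
  subst hij hjk
  exact (hX Y hY).2 i (by lia)

lemma IsDKernelOn.opSeq {X : ComposableArrows T (d + 1)} (hX : IsDKernelOn C X) :
    IsDCokernelOn C.op (opSeq X) := by
  intro Y hY
  refine ⟨?_, fun i hi => ?_⟩
  · intro g h w
    have w' : (g - h).unop ≫ X.map' (d + 1 + 1 - (d + 1 + 1)) (d + 1 + 1 - (d + 1)) = 0 := by
      have : (HigherAngle.opSeq X).map' d (d + 1) ≫ (g - h) = 0 := by
        rw [Preadditive.comp_sub, sub_eq_zero]; exact w
      exact congrArg Quiver.Hom.unop this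
    have := hX.eq_zero hY _ _ (by lia) (by lia) _ w'
    exact sub_eq_zero.1 (Quiver.Hom.unop_inj this)
  · intro g
    have := hX.exact hY (d + 1 + 1 - (i + 2 + 1)) (d + 1 + 1 - (i + 1 + 1))
      (d + 1 + 1 - (i + 1)) (by lia) (by lia) (by lia) g.unop
    constructor
    · intro w
      obtain ⟨z, hz⟩ := this.1 (congrArg Quiver.Hom.unop w)
      exact ⟨z.op, congrArg Quiver.Hom.op hz⟩
    · rintro ⟨z, hz⟩
      exact congrArg Quiver.Hom.op (this.2 ⟨z.unop, congrArg Quiver.Hom.unop hz⟩)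

lemma IsDKernelOn.of_opSeq {X : ComposableArrows T (d + 1)}
    (hX : IsDKernelOn C.op (HigherAngle.opSeq X)) : IsDCokernelOn C X := by
  intro Y hY
  refine ⟨?_, fun i hi => ?_⟩
  · have key : ∀ (p q : ℕ) (hp : p = d + 1 + 1 - (1 + 1)) (hq : q = d + 1 + 1 - (0 + 1))
        (hpq : p ≤ q) (hqd : q ≤ d + 1)
        (g : X.obj' q hqd ⟶ Y), X.map' p q hpq hqd ≫ g = 0 → g = 0 := by
      intro p q hp hq hpq hqd g w
      subst hp hq
      exact Quiver.Hom.op_inj (hX.eq_zero (Y := .op Y) hY 0 1 rfl rfl g.op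
        (congrArg Quiver.Hom.op w))
    intro g h w
    refine sub_eq_zero.1 (key d (d + 1) (by lia) (by lia) (by lia) le_rfl (g - h) ?_)
    rw [Preadditive.comp_sub, sub_eq_zero]
    exact w
  · have key : ∀ (p q r k : ℕ) (hk : k + 2 ≤ d + 1) (hp : p = d + 1 + 1 - (k + 2 + 1))
        (hq : q = d + 1 + 1 - (k + 1 + 1)) (hr : r = d + 1 + 1 - (k + 1))
        (hpq : p ≤ q) (hqr : q ≤ r) (hrd : r ≤ d + 1),
        Function.Exact (fun h : X.obj' r hrd ⟶ Y => X.map' q r hqr hrd ≫ h)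
          (fun h : X.obj' q ⟶ Y => X.map' p q hpq (hqr.trans hrd) ≫ h) := by
      intro p q r k hk hp hq hr hpq hqr hrd g
      subst hp hq hr
      have := hX.exact (Y := .op Y) hY k (k + 1) (k + 2) rfl rfl hk g.op
      constructor
      · intro w
        obtain ⟨z, hz⟩ := this.1 (congrArg Quiver.Hom.op w)
        exact ⟨z.unop, congrArg Quiver.Hom.unop hz⟩
      · rintro ⟨z, hz⟩
        exact congrArg Quiver.Hom.unop (this.2 ⟨z.op, congrArg Quiver.Hom.op hz⟩)
    exact key i (i + 1) (i + 2) (d - 1 - i) (by lia) (by lia) (by lia) (by lia) (by lia) (by lia)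
      (by lia)

lemma IsDCokernelOn.unopSeq {X : ComposableArrows Tᵒᵖ (d + 1)} (hX : IsDCokernelOn C.op X) :
    IsDKernelOn C (unopSeq X) := by
  intro Y hY
  refine ⟨?_, fun i hi => ?_⟩
  · intro g h w
    have w' : X.map' (d + 1 + 1 - (1 + 1)) (d + 1 + 1 - (0 + 1)) ≫ (g - h).op = 0 := by
      have : (g - h) ≫ (HigherAngle.unopSeq X).map' 0 1 = 0 := by
        rw [Preadditive.sub_comp, sub_eq_zero]; exact w
      exact congrArg Quiver.Hom.op this
    have := hX.eq_zero (Y := .op Y) hY _ _ (by lia) (by lia) _ w'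
    exact sub_eq_zero.1 (Quiver.Hom.op_inj this)
  · intro g
    have := hX.exact (Y := .op Y) hY (d + 1 + 1 - (i + 2 + 1)) (d + 1 + 1 - (i + 1 + 1))
      (d + 1 + 1 - (i + 1)) (by lia) (by lia) (by lia) g.op
    constructor
    · intro w
      obtain ⟨z, hz⟩ := this.1 (congrArg Quiver.Hom.op w)
      exact ⟨z.unop, congrArg Quiver.Hom.unop hz⟩
    · rintro ⟨z, hz⟩
      exact congrArg Quiver.Hom.unop (this.2 ⟨z.op, congrArg Quiver.Hom.op hz⟩)

/-- The comparison argument for resolutions: the next component extends a morphism that the previous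
differential of `X` kills. Components depend on the bound `i ≤ N`, so the recursion runs over all of
`ℕ` and is vacuous past the end. -/
lemma exists_chainMap {N : ℕ} {X P : ComposableArrows T N} (u₀ : ∀ _ : 0 ≤ N, X.obj' 0 ⟶ P.obj' 0)
    (u₁ : ∀ _ : 1 ≤ N, X.obj' 1 ⟶ P.obj' 1)
    (h₀ : ∀ h : 1 ≤ N, X.map' 0 1 ≫ u₁ h = u₀ (by lia) ≫ P.map' 0 1)
    (lift : ∀ (i : ℕ) (_ : i + 2 ≤ N) (f : X.obj' (i + 1) ⟶ P.obj' (i + 2)),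
      X.map' i (i + 1) ≫ f = 0 →
        ∃ g : X.obj' (i + 2) ⟶ P.obj' (i + 2), X.map' (i + 1) (i + 2) ≫ g = f)
    (hP : ∀ (i : ℕ) (_ : i + 2 ≤ N), P.map' i (i + 1) ≫ P.map' (i + 1) (i + 2) = 0) :
    ∃ u : ∀ (i : ℕ) (_ : i ≤ N), X.obj' i ⟶ P.obj' i, u 0 = u₀ ∧ u 1 = u₁ ∧
      ∀ (i : ℕ) (h : i + 1 ≤ N),
        X.map' i (i + 1) ≫ u (i + 1) h = u i (by lia) ≫ P.map' i (i + 1) := by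
  refine exists_seq (α := fun i => ∀ _ : i ≤ N, X.obj' i ⟶ P.obj' i)
    (fun i a b => ∀ (h : i + 1 ≤ N), X.map' i (i + 1) ≫ b h = a (by lia) ≫ P.map' i (i + 1))
    u₀ u₁ h₀ ?_
  intro i a b hab
  by_cases hi : i + 2 ≤ N
  · obtain ⟨g, hg⟩ := lift i hi (b (by lia) ≫ P.map' (i + 1) (i + 2)) (by
      rw [← Category.assoc, hab, Category.assoc, hP _ hi, comp_zero])
    exact ⟨fun _ => g, fun _ => hg⟩
  · exact ⟨fun h => absurd h hi, fun h => absurd h hi⟩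

/-- Two `d`-cokernels of the same morphism are homotopy equivalent; hence one of them is a
`d`-kernel if the other one is. -/
lemma IsDCokernelOn.isDKernelOn_of_iso {X P : ComposableArrows T (d + 1)}
    (hX : IsDCokernelOn C X) (hP : IsDCokernelOn C P) (hP' : IsDKernelOn C P)
    (hXC : ∀ i, C (X.obj i)) (hPC : ∀ i, C (P.obj i))
    (e : Arrow.mk (X.map' 0 1) ≅ Arrow.mk (P.map' 0 1)) : IsDKernelOn C X := by
  have cX : ∀ (i : ℕ) (_ : i + 2 ≤ d + 1),
      X.map' i (i + 1) ≫ X.map' (i + 1) (i + 2) = 0 := fun i hi =>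
    ((hX.exact (hXC ⟨i + 2, by lia⟩) i (i + 1) (i + 2) rfl rfl hi) _).2 ⟨𝟙 _, Category.comp_id _⟩
  have cP : ∀ (i : ℕ) (_ : i + 2 ≤ d + 1),
      P.map' i (i + 1) ≫ P.map' (i + 1) (i + 2) = 0 := fun i hi =>
    ((hP.exact (hPC ⟨i + 2, by lia⟩) i (i + 1) (i + 2) rfl rfl hi) _).2 ⟨𝟙 _, Category.comp_id _⟩
  obtain ⟨u, hu0, hu1, hu⟩ := exists_chainMap (X := X) (P := P) (fun _ => e.hom.left)
    (fun _ => e.hom.right) (fun _ => e.hom.w.symm)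
    (fun i hi f hf => (hX.exact (hPC ⟨i + 2, by lia⟩) i (i + 1) (i + 2) rfl rfl hi f).1 hf) cP
  obtain ⟨v, hv0, hv1, hv⟩ := exists_chainMap (X := P) (P := X) (fun _ => e.inv.left)
    (fun _ => e.inv.right) (fun _ => e.inv.w.symm)
    (fun i hi f hf => (hP.exact (hXC ⟨i + 2, by lia⟩) i (i + 1) (i + 2) rfl rfl hi f).1 hf) cX
  -- A homotopy between `u ≫ v` and the identity. It can start with two zeros because `u` and `v`
  -- are mutually inverse at position 1.
  obtain ⟨s, -, -, hs⟩ := exists_seq (α := fun i => ∀ _ : i + 1 ≤ d + 1, X.obj' (i + 1) ⟶ X.obj' i)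
    (fun i a b => ∀ (hi : i + 2 ≤ d + 1), 𝟙 _ - u (i + 1) (by lia) ≫ v (i + 1) _ =
      a (by lia) ≫ X.map' i (i + 1) + X.map' (i + 1) (i + 2) ≫ b (by lia))
    (fun _ => 0) (fun _ => 0) (by
      intro h
      have : e.hom.right ≫ e.inv.right = 𝟙 _ := by
        rw [← Arrow.comp_right, e.hom_inv_id]; rfl
      simp only [zero_comp, comp_zero, add_zero]
      rw [sub_eq_zero]
      exact this.symm.trans
        (congrArg₂ (· ≫ ·) (congrFun hu1 (by lia)) (congrFun hv1 (by lia))).symm) (by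
      intro i a b hab
      by_cases hi : i + 3 ≤ d + 1
      -- The defect of the homotopy is killed by the preceding differential, so it factors through
      -- the next one.
      · obtain ⟨g, hg⟩ := (hX.exact (hXC ⟨i + 2, _⟩) (i + 1) (i + 2) (i + 3) rfl rfl hi
          (𝟙 _ - u (i + 2) _ ≫ v (i + 2) _ - b _ ≫ X.map' (i + 1) (i + 2))).1
          (by
            have h1 := hab (by lia)
            have i₁ : i + 1 ≤ d + 1 := by lia
            have i₂ : i + 2 ≤ d + 1 := by lia
            have h2 : X.map' (i + 1) (i + 2) ≫ u (i + 2) i₂ ≫ v (i + 2) i₂ =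
                (u (i + 1) i₁ ≫ v (i + 1) i₁) ≫ X.map' (i + 1) (i + 2) := by
              rw [← Category.assoc, hu (i + 1) (by lia), Category.assoc, hv (i + 1) _,
                Category.assoc]
            have h3 : u (i + 1) i₁ ≫ v (i + 1) i₁ = 𝟙 _ -
              (a i₁ ≫ X.map' i (i + 1) + X.map' (i + 1) (i + 2) ≫ b i₂) := by
              rw [← h1]; abel
            rw [h3] at h2
            simp only [Preadditive.comp_sub, Preadditive.sub_comp, Preadditive.add_comp,
              Category.assoc, cX i (by lia), comp_zero, Category.comp_id, Category.id_comp] at h2 ⊢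
            rw [h2]
            abel)
        exact ⟨fun _ => g, fun _ => by
          rw [show X.map' (i + 1 + 1) (i + 1 + 2) ≫ g = _ from hg]
          abel⟩
      · exact ⟨fun _ => 0, fun h => absurd h (by lia)⟩)
  intro Y hY
  refine ⟨?_, fun i hi y => ⟨fun hy => ?_, ?_⟩⟩
  · intro g h w
    have w' : (g - h) ≫ X.map' 0 1 = 0 := by
      rw [Preadditive.sub_comp, sub_eq_zero]; exact w
    have h1 : ((g - h) ≫ e.hom.left) ≫ P.map' 0 1 = 0 := by
      have h2 : e.hom.left ≫ P.map' 0 1 = X.map' 0 1 ≫ e.hom.right := e.hom.w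
      rw [Category.assoc, h2, ← Category.assoc, w', zero_comp]
    have h2 := hP'.eq_zero hY 0 1 rfl rfl _ h1
    have : e.hom.left ≫ e.inv.left = 𝟙 _ := by
      rw [← Arrow.comp_left, e.hom_inv_id]; rfl
    rw [← sub_eq_zero, ← Category.comp_id (g - h)]
    change (g - h) ≫ 𝟙 (Arrow.mk (X.map' 0 1)).left = 0
    rw [← this, ← Category.assoc, h2, zero_comp]
  · dsimp only at hy
    obtain ⟨z, hz⟩ := (hP'.exact hY i (i + 1) (i + 2) rfl rfl (by lia)
      (y ≫ u (i + 1) (by lia))).1 (by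
        dsimp only
        rw [Category.assoc, ← hu (i + 1) (by lia), ← Category.assoc, hy, zero_comp])
    dsimp only at hz
    -- For a cycle `y` the homotopy writes `y` as `y ≫ u ≫ v` plus a boundary, and `y ≫ u` is a
    -- boundary in `P`.
    refine ⟨z ≫ v i _ + y ≫ s i _, ?_⟩
    have h1 := congrArg (fun t => y ≫ t) (hs i (by lia))
    simp only [Preadditive.comp_sub, Preadditive.comp_add, Category.comp_id] at h1
    rw [← Category.assoc y (u _ _), ← hz, ← Category.assoc y (X.map' (i + 1) (i + 2)), hy,
      zero_comp, add_zero, Category.assoc, hv i] at h1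
    simp only [Preadditive.add_comp, Category.assoc]
    rw [← h1]
    exact add_sub_cancel _ _
  · rintro ⟨z, rfl⟩
    dsimp only
    rw [Category.assoc, cX i (by lia), comp_zero]

end Relative

/-! ### Truncating long exact sequences -/

section Truncation

variable {T : Type u} [Category.{v} T] [Preadditive T]

/-- `X` is a direct sum of an object of `C` and an object of `U`. -/
def IsSumOf (C U : ObjectProperty T) (X : T) : Prop :=
  ∃ (L R : T) (i : L ⟶ X) (p : X ⟶ L) (j : R ⟶ X) (r : X ⟶ R),
    C L ∧ U R ∧ i ≫ p = 𝟙 L ∧ j ≫ r = 𝟙 R ∧ p ≫ i + r ≫ j = 𝟙 X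

/-- A sequence `Q₀ ⟶ Q₁ ⟶ ⋯` that extends `f : A ⟶ B` to the right, that is exact under all
covariant and contravariant `Hom` functors, and whose terms are sums of objects of `C` and `U`,
the objects of `U` being the ones that are removed when the sequence is truncated to a
sequence `Q₀ ⟶ ⋯ ⟶ Q_{d+1}` of objects of `C`. -/
structure IsRightExtension (C U : ObjectProperty T) (d : ℕ) {A B : T} (f : A ⟶ B)
    (Q : ℕ → T) (q : ∀ i, Q i ⟶ Q (i + 1)) : Prop where
  iso : Nonempty (Arrow.mk (q 0) ≅ Arrow.mk f)
  comp_eq_zero : ∀ i, q i ≫ q (i + 1) = 0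
  exists_desc : ∀ (i : ℕ) {Y : T} (h : Q (i + 1) ⟶ Y), q i ≫ h = 0 → ∃ g, q (i + 1) ≫ g = h
  exists_lift : ∀ (i : ℕ) {Y : T} (y : Y ⟶ Q (i + 1)), y ≫ q (i + 1) = 0 → ∃ z, z ≫ q i = y
  isSumOf : ∀ i, IsSumOf C U (Q i)
  last : U (Q (d + 2))
  last_of_mono : (∀ Z, C Z → ∀ g : Z ⟶ A, g ≫ f = 0 → g = 0) →
    ∀ Z, U Z → ∀ g : Z ⟶ Q (d + 1), g ≫ q (d + 1) = 0

variable {C U : ObjectProperty T} {d : ℕ} {A B : T} {f : A ⟶ B}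

/-- Morphisms from `Q k` to objects of `C` factor uniquely through the summand `L k`, so
contravariant exactness descends at once. For covariant exactness the summands `R k` are in the way;
they form a subcomplex with differential `t`, whose contraction corrects a cycle of the `L k` to a
cycle of `Q`. -/
lemma IsRightExtension.exists_isDCokernelOn {Q : ℕ → T} {q : ∀ i, Q i ⟶ Q (i + 1)}
    (h : IsRightExtension C U d f Q q) (hUC : ∀ Z Y, U Z → C Y → ∀ g : Z ⟶ Y, g = 0)
    (hA : C A) (hB : C B) :
    ∃ P : ComposableArrows T (d + 1), (∀ i, C (P.obj i)) ∧
      Nonempty (Arrow.mk (P.map' 0 1) ≅ Arrow.mk f) ∧ IsDCokernelOn C P ∧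
      ((∀ Z, C Z → ∀ g : Z ⟶ A, g ≫ f = 0 → g = 0) → IsDKernelOn C P) := by
  obtain ⟨⟨e⟩, hq, desc, lift, hsum, hlast, hmono⟩ := h
  choose L R i p j r hL hR hip hjr hsum using hsum
  have hrest : ∀ (k : ℕ) {Z : T} (x : Q k ⟶ Z), C Z → p k ≫ i k ≫ x = x := fun k Z x hZ => by
    rw [← Category.assoc, ← sub_eq_iff_eq_add.2 (hsum k).symm, Preadditive.sub_comp,
      Category.assoc, hUC _ _ (hR k) hZ (j k ≫ x), comp_zero, sub_zero, Category.id_comp]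
  let l : ∀ k, L k ⟶ L (k + 1) := fun k => i k ≫ q k ≫ p (k + 1)
  have hl : ∀ k, p k ≫ l k = q k ≫ p (k + 1) := fun k => hrest k _ (hL _)
  have hll : ∀ k, l k ≫ l (k + 1) = 0 := fun k => by
    have : l k ≫ l (k + 1) = i k ≫ q k ≫ p (k + 1) ≫ l (k + 1) := by
      simp only [l, Category.assoc]
    rw [this, hl, ← Category.assoc (q k), hq, zero_comp, comp_zero]
  let P : ComposableArrows T (d + 1) := ComposableArrows.mkOfObjOfMapSucc
    (fun k : Fin (d + 1 + 1) => L k.val)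
    (fun k : Fin (d + 1) => l k.val)
  have hP : ∀ (k : ℕ) (hk : k < d + 1), (P.map' k (k + 1) : L k ⟶ L (k + 1)) = l k := fun k hk =>
    ComposableArrows.mkOfObjOfMapSucc_map_succ (fun k : Fin (d + 1 + 1) => L k.val)
      (fun k : Fin (d + 1) => l k.val) k hk
  have hPP : ∀ (k : ℕ) (hk : k < d), P.map' k (k + 1) ≫ P.map' (k + 1) (k + 2) = 0 :=
    fun k hk => (congrArg₂ (fun (x : L k ⟶ L (k + 1)) (y : L (k + 1) ⟶ L (k + 2)) => x ≫ y)
      (hP k (by lia)) (hP (k + 1) (by lia))).trans (hll k)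
  have hpi₀ : p 0 ≫ i 0 = 𝟙 _ := by
    have : p 0 ≫ i 0 ≫ e.hom.left = e.hom.left := hrest 0 e.hom.left hA
    rw [← cancel_mono e.hom.left, Category.assoc, Category.id_comp]
    exact this
  have hpi₁ : p 1 ≫ i 1 = 𝟙 _ := by
    have : p 1 ≫ i 1 ≫ e.hom.right = e.hom.right := hrest 1 e.hom.right hB
    rw [← cancel_mono e.hom.right, Category.assoc, Category.id_comp]
    exact this
  refine ⟨P, fun k => hL k.val, ⟨?_⟩, ?_, ?_⟩
  · refine Arrow.isoMk' (P.map' 0 1) (q 0) (Iso.mk (X := L 0) (i 0) (p 0) (hip 0) hpi₀)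
      (Iso.mk (X := L 1) (i 1) (p 1) (hip 1) hpi₁) ?_ ≪≫ e
    refine Eq.trans ?_ (congrArg (fun x : L 0 ⟶ L 1 => x ≫ i 1) (hP 0 (by lia))).symm
    change i 0 ≫ q 0 = l 0 ≫ i 1
    simp only [l, Category.assoc]
    rw [hpi₁, Category.comp_id]
  · intro Y hY
    refine ⟨fun g g' w => ?_, fun k hk g => ⟨fun w => ?_, ?_⟩⟩
    · change L (d + 1) ⟶ Y at g g'
      replace w : l d ≫ g = l d ≫ g' := (congrArg (fun x : L d ⟶ L (d + 1) => x ≫ g)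
        (hP d (by lia))).symm.trans (w.trans (congrArg (fun x : L d ⟶ L (d + 1) => x ≫ g')
        (hP d (by lia))))
      rw [← sub_eq_zero, ← Preadditive.comp_sub] at w
      refine (sub_eq_zero (a := g) (b := g')).1 ?_
      generalize g - g' = g at w ⊢
      -- The extension `y` starts at `Q (d + 2)`, which lies in `U`; hence it is zero.
      obtain ⟨y, hy⟩ := desc d (p (d + 1) ≫ g) (by
        rw [← Category.assoc, ← hl, Category.assoc, w, comp_zero])
      rw [hUC _ _ hlast hY y, comp_zero] at hy
      calc g = i (d + 1) ≫ p (d + 1) ≫ g := by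
            rw [← Category.assoc, hip, Category.id_comp]
        _ = 0 := by rw [← hy, comp_zero]
    · change L (k + 1) ⟶ Y at g
      replace w : l k ≫ g = 0 := (congrArg (fun x : L k ⟶ L (k + 1) => x ≫ g)
        (hP k (by lia))).symm.trans w
      obtain ⟨y, hy⟩ := desc k (p (k + 1) ≫ g) (by
        rw [← Category.assoc, ← hl, Category.assoc, w, comp_zero])
      refine ⟨i (k + 2) ≫ y, (congrArg (fun x : L (k + 1) ⟶ L (k + 2) => x ≫ i (k + 2) ≫ y)
        (hP (k + 1) (by lia))).trans ?_⟩
      calc l (k + 1) ≫ i (k + 2) ≫ y = i (k + 1) ≫ q (k + 1) ≫ p (k + 2) ≫ i (k + 2) ≫ y := by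
            simp only [l, Category.assoc]
        _ = g := by rw [hrest (k + 2) y hY, hy, ← Category.assoc, hip, Category.id_comp]
    · rintro ⟨z, rfl⟩
      dsimp only
      rw [← Category.assoc, hPP k hk]
      exact zero_comp
  · intro hf
    let t : ∀ k, R k ⟶ R (k + 1) := fun k => j k ≫ q k ≫ r (k + 1)
    have ht : ∀ k, j k ≫ q k = t k ≫ j (k + 1) := fun k => by
      rw [← Category.comp_id (j k ≫ q k), ← hsum (k + 1), Preadditive.comp_add,
        ← Category.assoc, hUC _ _ (hR k) (hL (k + 1)) ((j k ≫ q k) ≫ p (k + 1)), zero_comp,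
        zero_add]
      simp only [t, Category.assoc]
    have hrj : ∀ (k : ℕ) {Z : T} (x : Z ⟶ Q k), x ≫ p k = 0 → x ≫ r k ≫ j k = x :=
      fun k Z x hx => by
        rw [← sub_eq_iff_eq_add'.2 (hsum k).symm, Preadditive.comp_sub, ← Category.assoc, hx,
          zero_comp, sub_zero, Category.comp_id]
    -- Given a quasi-inverse `s` of `t (k + 1)`, the map `𝟙 - t (k + 1) ≫ s` consists of cycles, so
    -- it lifts along `q k`. The lift has no component in `L k`, as it starts in `U`: this is one
    -- step of the contraction.
    have split : ∀ (k : ℕ) (s : R (k + 2) ⟶ R (k + 1)), t (k + 1) ≫ s ≫ t (k + 1) = t (k + 1) →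
        ∃ s' : R (k + 1) ⟶ R k, s' ≫ t k = 𝟙 _ - t (k + 1) ≫ s := fun k s hs => by
      obtain ⟨z, hz⟩ := lift k ((𝟙 _ - t (k + 1) ≫ s) ≫ j (k + 1)) (by
        rw [Category.assoc, ht, ← Category.assoc, Preadditive.sub_comp, Category.id_comp,
          Category.assoc, hs, sub_self, zero_comp])
      refine ⟨z ≫ r k, ?_⟩
      have h1 : z ≫ r k ≫ j k = z := hrj k z (hUC _ _ (hR _) (hL _) _)
      have h2 : ((z ≫ r k) ≫ t k) ≫ j (k + 1) = (𝟙 _ - t (k + 1) ≫ s) ≫ j (k + 1) := by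
        rw [Category.assoc, ← ht, ← hz]
        simp only [← Category.assoc] at h1 ⊢
        rw [h1]
      calc (z ≫ r k) ≫ t k = (((z ≫ r k) ≫ t k) ≫ j (k + 1)) ≫ r (k + 1) := by
            rw [Category.assoc _ (j (k + 1)), hjr, Category.comp_id]
        _ = 𝟙 _ - t (k + 1) ≫ s := by rw [h2, Category.assoc, hjr, Category.comp_id]
    -- Descending induction on `k`, with `c` the distance to `d + 1`. Monicity of `f` gives `t (d +
    -- 1) = 0`, with quasi-inverse `0`; and the `s'` supplied by `split` is a quasi-inverse one step
    -- lower.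
    have regular : ∀ (c k : ℕ), k + c = d + 1 →
        ∃ s : R (k + 1) ⟶ R k, t k ≫ s ≫ t k = t k := by
      intro c
      induction c with
      | zero =>
        intro k hk
        obtain rfl : k = d + 1 := hk
        refine ⟨0, ?_⟩
        have := hmono hf _ (hR (d + 1)) (j (d + 1))
        simp only [t]
        rw [← Category.assoc (j (d + 1)), this]
        simp only [zero_comp]
      | succ c ih =>
        intro k hk
        obtain ⟨s, hs⟩ := ih (k + 1) (by lia)
        obtain ⟨s', hs'⟩ := split k s hs
        refine ⟨s', ?_⟩
        have htt : t k ≫ t (k + 1) = 0 := by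
          have h3 : t k ≫ t (k + 1) ≫ j (k + 2) = 0 := by
            rw [← ht (k + 1), ← Category.assoc, ← ht, Category.assoc, hq, comp_zero]
          calc t k ≫ t (k + 1) = (t k ≫ t (k + 1) ≫ j (k + 2)) ≫ r (k + 2) := by
                simp only [Category.assoc, hjr, Category.comp_id]
            _ = 0 := by rw [h3, zero_comp]
        rw [hs', Preadditive.comp_sub, ← Category.assoc, htt, zero_comp, sub_zero,
          Category.comp_id]
    intro Y hY
    refine ⟨fun g g' w => ?_, fun k hk g => ⟨fun w => ?_, ?_⟩⟩
    · change Y ⟶ L 0 at g g'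
      replace w : g ≫ l 0 = g' ≫ l 0 := (congrArg (fun x : L 0 ⟶ L 1 => g ≫ x)
        (hP 0 (by lia))).symm.trans (w.trans (congrArg (fun x : L 0 ⟶ L 1 => g' ≫ x)
        (hP 0 (by lia))))
      rw [← sub_eq_zero, ← Preadditive.sub_comp] at w
      refine (sub_eq_zero (a := g) (b := g')).1 ?_
      generalize g - g' = g at w ⊢
      have h1 : g ≫ i 0 ≫ q 0 = 0 := by
        rw [← Category.comp_id (q 0), ← hpi₁]
        have : g ≫ l 0 ≫ i 1 = 0 := by rw [← Category.assoc, w, zero_comp]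
        simpa only [l, Category.assoc] using this
      have h2 : (g ≫ i 0 ≫ e.hom.left) ≫ f = 0 := by
        have : e.hom.left ≫ f = q 0 ≫ e.hom.right := e.hom.w
        simp only [Category.assoc]
        rw [this]
        simp only [← Category.assoc] at h1 ⊢
        rw [h1, zero_comp]
      have h3 := hf _ hY _ h2
      have h4 : g ≫ i 0 = 0 := by
        rwa [← Category.assoc, ← zero_comp (f := e.hom.left), cancel_mono] at h3
      calc g = (g ≫ i 0) ≫ p 0 := by rw [Category.assoc, hip, Category.comp_id]
        _ = 0 := by rw [h4, zero_comp]
    · change Y ⟶ L (k + 1) at g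
      replace w : g ≫ l (k + 1) = 0 := (congrArg (fun x : L (k + 1) ⟶ L (k + 2) => g ≫ x)
        (hP (k + 1) (by lia))).symm.trans w
      obtain ⟨s, hs⟩ := regular (d - 1 - k) (k + 2) (by lia)
      obtain ⟨s', hs'⟩ := split (k + 1) s hs
      have hw : (g ≫ i (k + 1) ≫ q (k + 1)) ≫ r (k + 2) ≫ j (k + 2) =
          g ≫ i (k + 1) ≫ q (k + 1) := hrj _ _ (by simpa only [l, Category.assoc] using w)
      let x : Y ⟶ R (k + 2) := g ≫ i (k + 1) ≫ q (k + 1) ≫ r (k + 2)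
      have hx : x ≫ j (k + 2) = g ≫ i (k + 1) ≫ q (k + 1) := by
        simpa only [x, Category.assoc] using hw
      have hxt : x ≫ t (k + 2) = 0 := by
        have : x ≫ t (k + 2) ≫ j (k + 3) = 0 := by
          rw [← ht (k + 2), ← Category.assoc, hx]
          simp only [Category.assoc]
          rw [hq, comp_zero, comp_zero]
        calc x ≫ t (k + 2) = (x ≫ t (k + 2) ≫ j (k + 3)) ≫ r (k + 3) := by
              simp only [Category.assoc, hjr, Category.comp_id]
          _ = 0 := by rw [this, zero_comp]
      have hx' : (x ≫ s') ≫ t (k + 1) = x := by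
        rw [Category.assoc, hs', Preadditive.comp_sub, ← Category.assoc, hxt, zero_comp, sub_zero,
          Category.comp_id]
      -- `g ≫ i (k + 1)` is a cycle only up to its `R`-component `x`; the contraction makes `x` a
      -- boundary, which is subtracted. The correction disappears after projecting to `L (k + 1)`.
      obtain ⟨z, hz⟩ := lift k (g ≫ i (k + 1) - (x ≫ s') ≫ j (k + 1)) (by
        rw [Preadditive.sub_comp, Category.assoc, Category.assoc, ht, ← Category.assoc (x ≫ s'),
          hx', hx, sub_self])
      refine ⟨z ≫ p k, (congrArg (fun x : L k ⟶ L (k + 1) => (z ≫ p k) ≫ x)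
        (hP k (by lia))).trans ?_⟩
      rw [Category.assoc, hl, ← Category.assoc, hz, Preadditive.sub_comp, Category.assoc, hip,
        Category.comp_id, Category.assoc, hUC _ _ (hR _) (hL _) (j (k + 1) ≫ p (k + 1)), comp_zero,
        sub_zero]
    · rintro ⟨z, rfl⟩
      dsimp only
      rw [Category.assoc, hPP k hk]
      exact comp_zero

end Truncation

/-! ### Rotations of sequences and exactness of angles -/

section Angles

variable {T : Type u} [Category.{v} T]

lemma exists_composableArrows {N : ℕ} (O : ∀ i : ℕ, i ≤ N → T)
    (M : ∀ (i : ℕ) (h : i + 1 ≤ N), O i (by lia) ⟶ O (i + 1) h) :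
    ∃ (X : ComposableArrows T N) (e : ∀ (i : ℕ) (h : i ≤ N), X.obj' i h ≅ O i h),
      ∀ (i : ℕ) (h : i + 1 ≤ N),
        X.map' i (i + 1) ≫ (e (i + 1) h).hom = (e i (by lia)).hom ≫ M i h := by
  refine ⟨ComposableArrows.mkOfObjOfMapSucc (fun i : Fin (N + 1) => O i.val (by lia))
    (fun i : Fin N => M i.val (by lia)), fun i h => Iso.refl _, fun i h => ?_⟩
  refine (Category.comp_id _).trans (Eq.trans ?_ (Category.id_comp _).symm)
  exact ComposableArrows.mkOfObjOfMapSucc_map_succ (fun i : Fin (N + 1) => O i.val (by lia))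
    (fun i : Fin N => M i.val (by lia)) i h

lemma exists_composableArrows_snoc {N : ℕ} (O : ∀ i : ℕ, i ≤ N → T)
    (M : ∀ (i : ℕ) (h : i + 1 ≤ N), O i (by lia) ⟶ O (i + 1) h) {Z : T} (g : O N le_rfl ⟶ Z) :
    ∃ (X : ComposableArrows T (N + 1)) (e : ∀ (i : ℕ) (h : i ≤ N), X.obj' i (by lia) ≅ O i h)
      (e' : X.obj' (N + 1) ≅ Z),
      (∀ (i : ℕ) (h : i + 1 ≤ N),
        X.map' i (i + 1) ≫ (e (i + 1) h).hom = (e i (by lia)).hom ≫ M i h) ∧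
      X.map' N (N + 1) ≫ e'.hom = (e N le_rfl).hom ≫ g := by
  let O' : ∀ i : ℕ, T := fun i => if h : i ≤ N then O i h else Z
  have hO : ∀ (i : ℕ) (h : i ≤ N), O' i = O i h := fun i h => dif_pos h
  have hO' : O' (N + 1) = Z := dif_neg (by lia)
  let M' : ∀ i : ℕ, i + 1 ≤ N + 1 → (O' i ⟶ O' (i + 1)) := fun i hi =>
    if h : i + 1 ≤ N then eqToHom (hO i (by lia)) ≫ M i h ≫ eqToHom (hO (i + 1) h).symm
    else
      have hN : i = N := by lia
      eqToHom (by subst hN; exact hO i le_rfl) ≫ g ≫ eqToHom (by subst hN; exact hO'.symm)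
  obtain ⟨X, e, he⟩ := exists_composableArrows (N := N + 1) (fun i _ => O' i) M'
  refine ⟨X, fun i h => e i (by lia) ≪≫ eqToIso (hO i h),
    e (N + 1) le_rfl ≪≫ eqToIso hO', fun i h => ?_, ?_⟩
  · have : M' i (by lia) = eqToHom (hO i (by lia)) ≫ M i h ≫ eqToHom (hO (i + 1) h).symm :=
      dif_pos h
    simp only [Iso.trans_hom, eqToIso.hom]
    rw [← Category.assoc, he i (by lia), this]
    simp
  · have : M' N le_rfl = eqToHom (hO N le_rfl) ≫ g ≫ eqToHom hO'.symm :=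
      dif_neg (by lia)
    simp only [Iso.trans_hom, eqToIso.hom]
    rw [← Category.assoc, he N le_rfl, this]
    simp

variable {S : T ≌ T} {n : ℕ}

lemma SSeq.Hom.w {X Y : SSeq S n} (f : SSeq.Hom X Y) (i : ℕ) (hi : i ≤ n) :
    X.d i ≫ f.φ (i + 1) = f.φ i ≫ Y.d i :=
  ComposableArrows.naturality' f.app i (i + 1)

variable [Preadditive T]

lemma neg_one_pow_smul_smul (k : ℕ) {X Y : T} (f : X ⟶ Y) :
    (-1 : ℤ) ^ k • (-1 : ℤ) ^ k • f = f := by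
  rw [smul_smul, ← mul_pow]
  simp

/-- Multiplication by a sign, as an automorphism. -/
def signIso (k : ℕ) (X : T) : X ≅ X where
  hom := (-1 : ℤ) ^ k • 𝟙 X
  inv := (-1 : ℤ) ^ k • 𝟙 X
  hom_inv_id := by
    rw [Preadditive.zsmul_comp, Category.id_comp, neg_one_pow_smul_smul]
  inv_hom_id := by
    rw [Preadditive.zsmul_comp, Category.id_comp, neg_one_pow_smul_smul]

lemma exists_isRotation (X : SSeq S n) : ∃ Y : SSeq S n, X.IsRotation Y := by
  obtain ⟨Y, e, e', h, h'⟩ := exists_composableArrows_snoc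
    (fun (i : ℕ) (hi : i ≤ n) => X.obj (i + 1)) (fun i hi => X.d (i + 1)) X.conn
  refine ⟨⟨Y, e'.hom ≫ ((-1 : ℤ) ^ (n + 2) • S.functor.map (X.d 0)) ≫
    S.functor.map (e 0 (by lia)).inv⟩, e, e', h, h', ?_⟩
  rw [Category.assoc, Category.assoc, ← Functor.map_comp, Iso.inv_hom_id, CategoryTheory.Functor.map_id,
    Category.comp_id]

lemma exists_isRotation_left (Y : SSeq S n) : ∃ X : SSeq S n, X.IsRotation Y := by
  -- The sign is there to cancel the one that rotating back introduces.
  let g : S.inverse.obj (Y.obj (n + 1)) ⟶ Y.obj 0 := S.functor.preimage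
    ((-1 : ℤ) ^ (n + 2) • (S.counitIso.hom.app (Y.obj (n + 1)) ≫ Y.conn))
  have hg : S.functor.map g =
      (-1 : ℤ) ^ (n + 2) • (S.counitIso.hom.app (Y.obj (n + 1)) ≫ Y.conn) :=
    S.functor.map_preimage _
  refine ⟨⟨Y.arrows.δlast.precomp g, Y.d n ≫ S.counitIso.inv.app (Y.obj (n + 1))⟩,
    fun i hi => Iso.refl _, S.counitIso.symm.app (Y.obj (n + 1)), fun i hi => ?_, ?_, ?_⟩
  · exact (Category.comp_id _).trans (Category.id_comp _).symm
  · exact (Category.id_comp _).symm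
  · refine Eq.trans ((congrArg _ (S.functor.map_id _)).trans (Category.comp_id _)) ?_
    change Y.conn = S.counitIso.inv.app (Y.obj (n + 1)) ≫ ((-1 : ℤ) ^ (n + 2) • S.functor.map g)
    rw [hg, neg_one_pow_smul_smul, Iso.inv_hom_id_app_assoc]

variable [HasFiniteBiproducts T]

lemma exists_isTrivial (Y : T) : ∃ X : SSeq S n, X.IsTrivial ∧ Nonempty (X.obj 0 ≅ Y) := by
  obtain ⟨Z, hZ⟩ := (hasZeroObject_of_hasFiniteBiproducts T).zero
  let O : ℕ → T := fun i => if i ≤ 1 then Y else Z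
  have h₀ : O 0 = Y := if_pos (by lia)
  have h₁ : O 1 = Y := if_pos (by lia)
  let M : ∀ i : ℕ, O i ⟶ O (i + 1) := fun i =>
    if h : i = 0 then eqToHom (by subst h; exact h₀.trans h₁.symm) else 0
  obtain ⟨X, e, he⟩ := exists_composableArrows (N := n + 1) (fun i _ => O i) (fun i _ => M i)
  refine ⟨⟨X, 0⟩, ⟨?_, fun i hi hi' => ?_⟩, ⟨e 0 (by lia) ≪≫ eqToIso h₀⟩⟩
  · have h := he 0 (by lia)
    have : M 0 = eqToHom (h₀.trans h₁.symm) := dif_pos rfl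
    rw [this, ← Iso.eq_comp_inv] at h
    change IsIso (X.map' 0 1)
    rw [h]
    infer_instance
  · have : O i = Z := if_neg (by lia)
    exact hZ.of_iso (e i hi' ≪≫ eqToIso this)

/-! ### Exactness of `Hom` on angles, by comparison with trivial angles -/

variable (𝒜 : Angulation S n)


/-- The trivial angle on `X₀` maps to `X`, and its term at position 2 is zero; the composite factors
through it. -/
lemma Angulation.comp_eq_zero (hn : 1 ≤ n) {X : SSeq S n} (hX : 𝒜.IsAngle X) :
    X.d 0 ≫ X.d 1 = 0 := by
  obtain ⟨t, ht, ⟨α⟩⟩ := exists_isTrivial (S := S) (n := n) (X.obj 0)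
  have := ht.1
  obtain ⟨f, hf₀, hf₁, -⟩ := 𝒜.exists_hom_cone t X (𝒜.of_isTrivial t ht) hX α.hom
    (inv (t.d 0 n.zero_le) ≫ α.hom ≫ X.d 0 n.zero_le) (by rw [IsIso.hom_inv_id_assoc])
  have h := f.w 1 hn
  rw [hf₁, (ht.2 2 le_rfl (by lia)).eq_of_src (f.φ 2 (by lia)) 0, comp_zero] at h
  rw [← cancel_epi α.hom, ← cancel_epi (inv (t.d 0 n.zero_le)), comp_zero, comp_zero]
  simpa only [Category.assoc] using h.symm

/-- The left rotation of the trivial angle on `Y` has `Y = Y` at positions 1 and 2. Extending `(0,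
h)` to a morphism from `X` to it produces the factorization as the component at position 2. -/
lemma Angulation.exists_desc (hn : 1 ≤ n) {X : SSeq S n} (hX : 𝒜.IsAngle X) {Y : T}
    (h : X.obj 1 ⟶ Y) (w : X.d 0 ≫ h = 0) : ∃ g, X.d 1 ≫ g = h := by
  obtain ⟨t, ht, ⟨α⟩⟩ := exists_isTrivial (S := S) (n := n) Y
  have := ht.1
  obtain ⟨E, hE⟩ := exists_isRotation_left t
  have hE' := (𝒜.rotation_iff E t hE).2 (𝒜.of_isTrivial t ht)
  obtain ⟨e, e', he, -, -⟩ := hE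
  obtain ⟨f, hf₀, hf₁, -⟩ := 𝒜.exists_hom_cone X E hX hE' 0 (h ≫ α.inv ≫ (e 0 n.zero_le).hom)
    (by rw [← Category.assoc, w, zero_comp, zero_comp])
  have h1 := f.w 1 hn
  have h2 := he 0 (by lia)
  refine ⟨f.φ 2 (by lia) ≫ (e 1 hn).inv ≫ inv (t.d 0 n.zero_le) ≫ α.hom, ?_⟩
  have h3 : E.d 1 hn ≫ (e 1 hn).inv ≫ inv (t.d 0 n.zero_le) = (e 0 n.zero_le).inv := by
    rw [← cancel_epi (e 0 n.zero_le).hom, Iso.hom_inv_id, ← Category.assoc, ← h2]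
    simp
  rw [← Category.assoc, h1, hf₁]
  simp only [Category.assoc] at h3 ⊢
  rw [← Category.assoc (e 1 hn).inv, ← Category.assoc (E.d 1), h3]
  simp

/-- Rotate both `X` and the trivial angle on `Y` to the right and extend `(y, 0)` to a morphism. Its
last component goes from `S Y` to `S X₀`, hence is `S z`; in the last square the two rotation signs
cancel. -/
lemma Angulation.exists_lift (hn : 1 ≤ n) {X : SSeq S n} (hX : 𝒜.IsAngle X) {Y : T}
    (y : Y ⟶ X.obj 1) (w : y ≫ X.d 1 = 0) : ∃ z, z ≫ X.d 0 = y := by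
  obtain ⟨t, ht, ⟨α⟩⟩ := exists_isTrivial (S := S) (n := n) Y
  have := ht.1
  obtain ⟨E, hE⟩ := exists_isRotation t
  have hE' := (𝒜.rotation_iff t E hE).1 (𝒜.of_isTrivial t ht)
  obtain ⟨e, e', he, -, he'⟩ := hE
  obtain ⟨R, hR⟩ := exists_isRotation X
  have hR' := (𝒜.rotation_iff X R hR).1 hX
  obtain ⟨r, r', hr, -, hr'⟩ := hR
  obtain ⟨f, hf₀, hf₁, -⟩ := 𝒜.exists_hom_cone E R hE' hR'
    ((e 0 n.zero_le).hom ≫ inv (t.d 0 n.zero_le) ≫ α.hom ≫ y ≫ (r 0 n.zero_le).inv) 0 (by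
      have h1 := hr 0 (by lia)
      rw [comp_zero, ← cancel_mono (r 1 hn).hom, zero_comp]
      simp only [Category.assoc]
      rw [h1, Iso.inv_hom_id_assoc, w]
      simp)
  have h1 := f.comm
  obtain ⟨z, hz⟩ := S.functor.map_surjective (e'.inv ≫ f.φ (n + 1) ≫ r'.hom)
  have h2 : E.conn = e'.hom ≫ ((-1 : ℤ) ^ (n + 2) • S.functor.map (t.d 0)) ≫
      S.functor.map (e 0 n.zero_le).inv := by
    rw [← Category.assoc, ← he', Category.assoc, ← Functor.map_comp, Iso.hom_inv_id,
      CategoryTheory.Functor.map_id, Category.comp_id]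
  have h3 : S.functor.map (α.hom ≫ y) = S.functor.map (z ≫ X.d 0) := by
    rw [← neg_one_pow_smul_smul (n + 2) (S.functor.map (α.hom ≫ y)),
      ← neg_one_pow_smul_smul (n + 2) (S.functor.map (z ≫ X.d 0))]
    congr 1
    rw [S.functor.map_comp z, hz, ← Preadditive.comp_zsmul]
    simp only [Category.assoc]
    rw [← hr', ← Category.assoc (f.φ (n + 1)), ← h1, h2]
    change _ = e'.inv ≫ (_ ≫ S.functor.map (f.φ 0)) ≫ _
    rw [hf₀]
    simp only [Category.assoc, Preadditive.zsmul_comp, Preadditive.comp_zsmul, ← Functor.map_comp,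
      Iso.inv_hom_id_assoc, Iso.inv_hom_id, IsIso.hom_inv_id_assoc, Category.comp_id]
  refine ⟨α.inv ≫ z, ?_⟩
  rw [Category.assoc, ← S.functor.map_injective h3, Iso.inv_hom_id_assoc]

end Angles

/-! ### Supports of objects -/

section Powers

variable {T : Type u} [Category.{v} T]

/-- Powers unfold with the additional copy of `S` applied first, whereas shifting degrees needs it
applied last; hence the induction over all `X`. -/
lemma exists_powNat_succ_iso (S : T ≌ T) (k : ℕ) (X : T) :
    Nonempty ((S.powNat (k + 1)).functor.obj X ≅ S.functor.obj ((S.powNat k).functor.obj X)) := by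
  induction k generalizing X with
  | zero => exact ⟨Iso.refl _⟩
  | succ k ih =>
    obtain ⟨e⟩ := ih (S.functor.obj X)
    refine ⟨e ≪≫ S.functor.mapIso (eqToIso ?_)⟩
    cases k <;> rfl

lemma exists_pow_succ_iso (S : T ≌ T) (j : ℤ) (X : T) :
    Nonempty ((S ^ (j + 1)).functor.obj X ≅ S.functor.obj ((S ^ j).functor.obj X)) := by
  obtain k | k := j
  · exact exists_powNat_succ_iso S k X
  · obtain ⟨e⟩ := exists_powNat_succ_iso S.symm k X
    have h : S ^ (Int.negSucc k + 1) = S.symm.powNat k := by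
      cases k <;> rfl
    rw [h]
    exact ⟨(S.counitIso.app _).symm ≪≫ S.functor.mapIso e.symm⟩

lemma succ_iff_of_eq_map {a : ℤ → ObjectProperty T} (S : T ≌ T) (hS : ∀ j : ℤ, a j = (a 0).map (S ^ j).functor)
    (j : ℤ) (Z : T) : a (j + 1) Z ↔ ∃ Z', a j Z' ∧ Nonempty (S.functor.obj Z' ≅ Z) := by
  rw [hS (j + 1), hS j]
  constructor
  · rintro ⟨X, hX, ⟨e⟩⟩
    obtain ⟨e'⟩ := exists_pow_succ_iso S j X
    exact ⟨_, ⟨X, hX, ⟨Iso.refl _⟩⟩, ⟨e'.symm ≪≫ e⟩⟩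
  · rintro ⟨Z', ⟨X, hX, ⟨e⟩⟩, ⟨e''⟩⟩
    obtain ⟨e'⟩ := exists_pow_succ_iso S j X
    exact ⟨X, hX, ⟨e' ≪≫ S.functor.mapIso e ≪≫ e''⟩⟩

end Powers

/-! ### Supports and decomposition by degree -/

section Support

variable {T : Type u} [Category.{v} T] [Preadditive T]

lemma IsSumOf.symm {C U : ObjectProperty T} {X : T} (h : IsSumOf C U X) : IsSumOf U C X := by
  obtain ⟨L, R, i, p, j, r, hL, hR, hip, hjr, hs⟩ := h
  exact ⟨R, L, j, r, i, p, hR, hL, hjr, hip, by rw [add_comm, hs]⟩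

lemma IsSumOf.op {C U : ObjectProperty T} {X : T} (h : IsSumOf C U X) :
    IsSumOf C.op U.op (Opposite.op X) := by
  obtain ⟨L, R, i, p, j, r, hL, hR, hip, hjr, hs⟩ := h
  exact ⟨.op L, .op R, p.op, i.op, r.op, j.op, hL, hR, congrArg Quiver.Hom.op hip,
    congrArg Quiver.Hom.op hjr, congrArg Quiver.Hom.op hs⟩

/-- The objects that have no nonzero direct summands in `a r` for `r ∉ I`. -/
def Supp (a : ℤ → ObjectProperty T) (I : Set ℤ) : ObjectProperty T := fun t =>
  ∀ r ∉ I, ∀ Z, a r Z → ∀ (f : Z ⟶ t) (g : t ⟶ Z), f ≫ g = 0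

variable {a : ℤ → ObjectProperty T} {I J : Set ℤ}

lemma Supp.of_retract {t P : T} (ht : Supp a I t) (i : P ⟶ t) (p : t ⟶ P) (h : i ≫ p = 𝟙 P) :
    Supp a I P := fun r hr Z hZ f g => by
  have := ht r hr Z hZ (f ≫ i) (p ≫ g)
  rwa [Category.assoc, ← Category.assoc i, h, Category.id_comp] at this

lemma Supp.of_iso {t P : T} (ht : Supp a I t) (e : t ≅ P) : Supp a I P :=
  ht.of_retract e.inv e.hom e.inv_hom_id

lemma Supp.mono {t : T} (ht : Supp a I t) (h : I ⊆ J) : Supp a J t :=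
  fun r hr => ht r fun h' => hr (h h')

lemma Supp.inter {t : T} (ht : Supp a I t) (ht' : Supp a J t) : Supp a (I ∩ J) t :=
  fun r hr => by
    by_cases h : r ∈ I
    · exact ht' r fun h' => hr ⟨h, h'⟩
    · exact ht r h

lemma Supp.of_sum {κ : Type*} [Fintype κ] {t : T} (x : κ → T) (hx : ∀ l, Supp a I (x l))
    (p : ∀ l, t ⟶ x l) (i : ∀ l, x l ⟶ t) (h : ∑ l, p l ≫ i l = 𝟙 t) : Supp a I t :=
  fun r hr Z hZ f g => by
    rw [← Category.id_comp g, ← h, Preadditive.sum_comp, Preadditive.comp_sum]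
    refine Finset.sum_eq_zero fun l _ => ?_
    have := hx l r hr Z hZ (f ≫ p l) (i l ≫ g)
    simpa only [Category.assoc] using this

variable [HasFiniteBiproducts T]

/-- The hypotheses on the subcategories `a j`: morphisms go up by at most one degree, every object
is a direct sum of homogeneous ones, and `S` has degree one. -/
structure IsGrading (S : T ≌ T) (a : ℤ → ObjectProperty T) : Prop where
  additive : ∀ j, IsAdditiveSubcategory (a j)
  eq_zero : ∀ i j : ℤ, j ≠ i → j ≠ i + 1 → ∀ A B : T, a i A → a j B → ∀ f : A ⟶ B, f = 0
  exists_sum : ∀ t : T, ∃ (i s : ℤ) (x : ℤ → T), (∀ j, a j (x j)) ∧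
    Nonempty (t ≅ ⨁ fun j : Finset.Icc i s => x j)
  succ_iff : ∀ (j : ℤ) (Z : T), a (j + 1) Z ↔
    ∃ Z', a j Z' ∧ Nonempty (S.functor.obj Z' ≅ Z)

namespace IsGrading

variable {S : T ≌ T} (ha : IsGrading S a)

include ha

/-- A nonzero round trip between degrees `s` and `r` needs both `r ∈ {s, s + 1}` and `s ∈ {r, r +
1}`, which forces `s = r`. -/
lemma supp_of_mem {r : ℤ} (hr : r ∈ I) {x : T} (hx : a r x) : Supp a I x := by
  intro s hs Z hZ f g
  have hne : s ≠ r := fun h => hs (h ▸ hr)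
  by_cases h : r = s + 1
  · rw [ha.eq_zero r s hne (by lia) x Z hx hZ g, comp_zero]
  · rw [ha.eq_zero s r hne.symm h Z x hZ hx f, zero_comp]

/-- In any decomposition, the identity of a summand is its inclusion followed by its projection, a
round trip through `t`; outside `I` this vanishes. -/
lemma exists_finite_sum {t : T} (ht : Supp a I t) :
    ∃ (κ : Finset ℤ) (x : κ → T), (∀ l : κ, a l (x l)) ∧ (∀ l : κ, (l : ℤ) ∉ I → 𝟙 (x l) = 0) ∧
      Nonempty (t ≅ ⨁ x) := by
  obtain ⟨i, s, x, hx, ⟨e⟩⟩ := ha.exists_sum t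
  refine ⟨Finset.Icc i s, fun j => x j, fun l => hx l, fun l hl => ?_, ⟨e⟩⟩
  have := ht l hl _ (hx l) (biproduct.ι (fun j : Finset.Icc i s => x j) l ≫ e.inv)
    (e.hom ≫ biproduct.π (fun j : Finset.Icc i s => x j) l)
  simpa using this

lemma hom_eq_zero (hIJ : ∀ r ∈ I, ∀ s ∈ J, s ≠ r ∧ s ≠ r + 1) {t t' : T} (ht : Supp a I t)
    (ht' : Supp a J t') (f : t ⟶ t') : f = 0 := by
  obtain ⟨κ, x, hx, hx0, ⟨e⟩⟩ := ha.exists_finite_sum ht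
  obtain ⟨κ', x', hx', hx0', ⟨e'⟩⟩ := ha.exists_finite_sum ht'
  rw [← cancel_epi e.inv, ← cancel_mono e'.hom, comp_zero, zero_comp]
  ext k' k
  simp only [comp_zero, zero_comp]
  rw [← Category.comp_id (biproduct.π x' _), ← Category.id_comp (biproduct.ι x _)]
  by_cases hk : (k : ℤ) ∈ I
  · by_cases hk' : (k' : ℤ) ∈ J
    · exact ha.eq_zero k k' (hIJ _ hk _ hk').1 (hIJ _ hk _ hk').2 _ _ (hx k) (hx' k') _
    · rw [hx0' k' hk']
      simp
  · rw [hx0 k hk]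
    simp

lemma isSumOf (c : ℤ) {t : T} (ht : Supp a I t) :
    IsSumOf (Supp a (I ∩ Set.Iic c)) (Supp a (I ∩ Set.Ici (c + 1))) t := by
  classical
  obtain ⟨κ, x, hx, -, ⟨e⟩⟩ := ha.exists_finite_sum ht
  let P : κ → Prop := fun l => (l : ℤ) ≤ c
  have key : ∀ (P : κ → Prop) (J : Set ℤ) (hP : ∀ l, P l → (l : ℤ) ∈ J),
      Supp a (I ∩ J) (⨁ Subtype.restrict P x) := fun P J hP => by
    refine (ht.of_retract (biproduct.fromSubtype x P ≫ e.inv)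
      (e.hom ≫ biproduct.toSubtype x P) (by simp)).inter ?_
    refine Supp.of_sum (Subtype.restrict P x) (fun l => ?_)
      (fun l => biproduct.π _ l) (fun l => biproduct.ι _ l) biproduct.total
    exact ha.supp_of_mem (hP _ l.2) (hx l.1)
  refine ⟨_, _, biproduct.fromSubtype x P ≫ e.inv, e.hom ≫ biproduct.toSubtype x P,
    biproduct.fromSubtype x (fun l => ¬ P l) ≫ e.inv,
    e.hom ≫ biproduct.toSubtype x (fun l => ¬ P l),
    key P _ fun l hl => hl, key _ _ fun l (hl : ¬ P l) => ?_, by simp, by simp, ?_⟩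
  · have : ¬ (l : ℤ) ≤ c := hl
    simp only [Set.mem_Ici]
    lia
  · have : biproduct.toSubtype x P ≫ biproduct.fromSubtype x P +
        biproduct.toSubtype x (fun l => ¬ P l) ≫ biproduct.fromSubtype x (fun l => ¬ P l) =
        𝟙 _ := by
      rw [biproduct.toSubtype_fromSubtype, biproduct.toSubtype_fromSubtype]
      ext i j
      by_cases h : P i <;> simp [h]
    have h2 := congrArg (fun y => e.hom ≫ y ≫ e.inv) this
    simpa using h2

lemma truncated_iff {i j : ℤ} (hij : i ≤ j) (t : T) :
    truncated a i j t ↔ Supp a (Set.Icc i j) t := by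
  constructor
  · rintro ⟨t', k, x, hx, ⟨e⟩⟩
    have : Supp a (Set.Icc i j) (⨁ x) := by
      refine Supp.of_sum x (fun l => ?_)
        (fun l => biproduct.π _ l) (fun l => biproduct.ι _ l) biproduct.total
      obtain ⟨r, h₁, h₂, h₃⟩ := hx l
      exact ha.supp_of_mem (Set.mem_Icc.2 ⟨h₁, h₂⟩) h₃
    exact this.of_retract (biprod.inl ≫ e.hom) (e.inv ≫ biprod.fst) (by simp)
  · intro ht
    obtain ⟨κ, x, hx, hx0, ⟨e⟩⟩ := ha.exists_finite_sum ht
    have := (ha.additive i).closedUnderIso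
    obtain ⟨O, hO, hO'⟩ := (ha.additive i).containsZero
    refine ⟨O, Fintype.card κ, fun l => x ((Fintype.equivFin κ).symm l), fun l => ?_, ⟨?_⟩⟩
    · set k := (Fintype.equivFin κ).symm l
      by_cases hk : (k : ℤ) ∈ Set.Icc i j
      · exact ⟨k, hk.1, hk.2, hx k⟩
      -- A summand outside the range is a zero object, so it may be counted in degree `i`.
      · refine ⟨i, le_rfl, hij, (a i).prop_of_iso (hO.iso ?_) hO'⟩
        exact (IsZero.iff_id_eq_zero _).2 (hx0 k hk)
    · exact (isoBiprodZero hO).symm ≪≫ e ≪≫ (biproduct.whiskerEquiv (Fintype.equivFin κ)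
        (fun l => eqToIso (by simp)) : ⨁ x ≅ ⨁ fun l => x ((Fintype.equivFin κ).symm l))

lemma supp_map {t : T} (ht : Supp a I t) (h : ∀ r ∈ I, r + 1 ∈ J) :
    Supp a J (S.functor.obj t) := by
  intro r hr Z hZ f g
  obtain ⟨Z', hZ', ⟨e⟩⟩ := (ha.succ_iff (r - 1) Z).1 (by rwa [sub_add_cancel])
  obtain ⟨f', hf⟩ := S.functor.map_surjective (e.hom ≫ f)
  obtain ⟨g', hg⟩ := S.functor.map_surjective (g ≫ e.inv)
  have := ht (r - 1) (fun h' => hr (by simpa using h _ h')) Z' hZ' f' g'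
  rw [← cancel_epi e.hom, ← cancel_mono e.inv]
  simp only [Category.assoc, comp_zero, zero_comp]
  rw [← hg, ← Category.assoc, ← hf, ← CategoryTheory.Functor.map_comp, this, CategoryTheory.Functor.map_zero]

lemma supp_of_map {t : T} (ht : Supp a J (S.functor.obj t)) (h : ∀ r, r + 1 ∈ J → r ∈ I) :
    Supp a I t := by
  intro r hr Z hZ f g
  have := ht (r + 1) (fun h' => hr (h _ h')) (S.functor.obj Z)
    ((ha.succ_iff r _).2 ⟨Z, hZ, ⟨Iso.refl _⟩⟩) (S.functor.map f) (S.functor.map g)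
  refine S.functor.map_injective ?_
  rw [CategoryTheory.Functor.map_comp, this, CategoryTheory.Functor.map_zero]

end IsGrading

end Support

/-! ### Iterated rotations -/

section Rotations

variable {T : Type u} [Category.{v} T] [Preadditive T] {S : T ≌ T} {n : ℕ}

namespace SSeq.IsRotation

variable {X Y : SSeq S n}

lemma arrow_iso_d (h : X.IsRotation Y) (i : ℕ) (hi : i < n) :
    Nonempty (Arrow.mk (Y.d i) ≅ Arrow.mk (X.d (i + 1))) := by
  obtain ⟨e, e', h, -, -⟩ := h
  exact ⟨Arrow.isoMk' _ _ (e i (by lia)) (e (i + 1) (by lia)) (h i hi).symm⟩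

lemma arrow_iso_last (h : X.IsRotation Y) : Nonempty (Arrow.mk (Y.d n) ≅ Arrow.mk X.conn) := by
  obtain ⟨e, e', -, h, -⟩ := h
  exact ⟨Arrow.isoMk' _ _ (e n le_rfl) e' h.symm⟩

/-- The sign of the rotation is absorbed into an automorphism of the target. -/
lemma arrow_iso_conn (h : X.IsRotation Y) :
    Nonempty (Arrow.mk Y.conn ≅ Arrow.mk (S.functor.map (X.d 0))) := by
  obtain ⟨e, e', -, -, h⟩ := h
  refine ⟨Arrow.isoMk' _ _ e' (S.functor.mapIso (e 0 (by lia)) ≪≫ signIso (n + 2) _) ?_⟩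
  simp only [Iso.trans_hom, Functor.mapIso_hom]
  rw [← Category.assoc, h]
  simp only [signIso, Preadditive.comp_zsmul, Category.comp_id]
  rw [neg_one_pow_smul_smul]

end SSeq.IsRotation

/-- After `n + 2` rotations a sequence becomes its suspension, up to signs. -/
lemma arrow_iso_of_rotations (R : ℕ → SSeq S n) (hR : ∀ k ≤ n + 1, (R k).IsRotation (R (k + 1))) :
    Nonempty (Arrow.mk ((R (n + 2)).d 0) ≅ Arrow.mk (S.functor.map ((R 0).d 0))) := by
  -- The suspended first morphism becomes the connecting morphism after one rotation and the
  -- morphism at position `n` after two; every further rotation moves it one place to the left.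
  have key : ∀ (j i : ℕ) (h : i + j = n),
      Nonempty (Arrow.mk ((R (j + 2)).d i) ≅ Arrow.mk (S.functor.map ((R 0).d 0))) := by
    intro j
    induction j with
    | zero =>
      intro i h
      obtain rfl : i = n := h
      obtain ⟨e⟩ := (hR 0 (by lia)).arrow_iso_conn
      obtain ⟨e'⟩ := (hR 1 (by lia)).arrow_iso_last
      exact ⟨e' ≪≫ e⟩
    | succ j ih =>
      intro i h
      obtain ⟨e⟩ := ih (i + 1) (by lia)
      obtain ⟨e'⟩ := (hR (j + 2) (by lia)).arrow_iso_d i (by lia)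
      exact ⟨e' ≪≫ e⟩
  exact key n 0 (by lia)

lemma arrow_iso_of_left_rotations (R : ℕ → SSeq S n) (hR : ∀ k, (R (k + 1)).IsRotation (R k))
    (k : ℕ) :
    Nonempty (Arrow.mk ((R k).d 0) ≅ Arrow.mk (S.functor.map ((R (k + (n + 2))).d 0))) := by
  have h := arrow_iso_of_rotations (fun l => R (k + (n + 2 - l))) fun l hl => by
    rw [show k + (n + 2 - l) = k + (n + 2 - (l + 1)) + 1 by lia]
    exact hR _
  beta_reduce at h
  rwa [Nat.sub_self, Nat.sub_zero, add_zero] at h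

/-- `Hom(Z, -)` is injective on `f` for all `Z` in degrees `≥ j`. -/
def MonoOn (a : ℤ → ObjectProperty T) (j : ℤ) {X Y : T} (f : X ⟶ Y) : Prop :=
  ∀ Z, Supp a (Set.Ici j) Z → ∀ g : Z ⟶ X, g ≫ f = 0 → g = 0

/-- `Hom(-, Z)` is injective on `f` for all `Z` in degrees `≤ j`. -/
def EpiOn (a : ℤ → ObjectProperty T) (j : ℤ) {X Y : T} (f : X ⟶ Y) : Prop :=
  ∀ Z, Supp a (Set.Iic j) Z → ∀ g : Y ⟶ Z, f ≫ g = 0 → g = 0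

variable {a : ℤ → ObjectProperty T} {j : ℤ}

lemma MonoOn.of_iso {X Y X' Y' : T} {f : X ⟶ Y} {f' : X' ⟶ Y'} (hf : MonoOn a j f)
    (e : Arrow.mk f ≅ Arrow.mk f') : MonoOn a j f' := by
  intro Z hZ g hg
  have h : e.inv.left ≫ f = f' ≫ e.inv.right := e.inv.w
  have := hf Z hZ (g ≫ e.inv.left) (by
    rw [Category.assoc, h, ← Category.assoc, hg, zero_comp])
  rwa [← zero_comp (f := e.inv.left), cancel_mono] at this

lemma EpiOn.of_iso {X Y X' Y' : T} {f : X ⟶ Y} {f' : X' ⟶ Y'} (hf : EpiOn a j f)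
    (e : Arrow.mk f ≅ Arrow.mk f') : EpiOn a j f' := by
  intro Z hZ g hg
  have h : e.hom.left ≫ f' = f ≫ e.hom.right := e.hom.w
  have := hf Z hZ (e.hom.right ≫ g) (by
    rw [← Category.assoc, ← h, Category.assoc, hg, comp_zero])
  rwa [← comp_zero (f := e.hom.right), cancel_epi] at this

variable [HasFiniteBiproducts T]

lemma IsGrading.monoOn_map (ha : IsGrading S a) {X Y : T} {f : X ⟶ Y} (hf : MonoOn a j f) :
    MonoOn a (j + 1) (S.functor.map f) := by
  intro Z hZ g hg
  let ε := S.counitIso.app Z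
  obtain ⟨g', hg'⟩ := S.functor.map_surjective (ε.hom ≫ g)
  have h0 := hf (S.inverse.obj Z) (ha.supp_of_map (hZ.of_iso ε.symm) fun r hr => by
    simpa using hr) g' (S.functor.map_injective (by
      rw [CategoryTheory.Functor.map_comp, hg', Category.assoc, hg, comp_zero, CategoryTheory.Functor.map_zero]))
  rw [h0, CategoryTheory.Functor.map_zero] at hg'
  rw [← cancel_epi ε.hom, ← hg', comp_zero]

lemma IsGrading.epiOn_of_map (ha : IsGrading S a) {X Y : T} {f : X ⟶ Y}
    (hf : EpiOn a j (S.functor.map f)) : EpiOn a (j - 1) f := by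
  intro Z hZ g hg
  refine S.functor.map_injective ?_
  rw [CategoryTheory.Functor.map_zero]
  refine hf _ (ha.supp_map hZ fun r hr => ?_) _ (by rw [← CategoryTheory.Functor.map_comp, hg, CategoryTheory.Functor.map_zero])
  simp only [Set.mem_Iic] at hr ⊢
  lia

/-- The part of a test object in degrees greater than `m` has no nonzero morphism to `A`, so testing
on degrees `0, …, m` suffices. -/
lemma IsGrading.monoOn_zero (ha : IsGrading S a) (m : ℕ) {A B : T} {f : A ⟶ B}
    (hA : Supp a (Set.Icc 0 (m : ℤ)) A)
    (hf : ∀ Z, Supp a (Set.Icc 0 (m : ℤ)) Z → ∀ g : Z ⟶ A, g ≫ f = 0 → g = 0) :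
    MonoOn a 0 f := by
  intro Z hZ g hg
  obtain ⟨L, R, i, p, j, r, hL, hR, hip, hjr, hs⟩ := ha.isSumOf m hZ
  have h1 := hf L (hL.mono fun x hx => ⟨hx.1, hx.2⟩) (i ≫ g) (by
    rw [Category.assoc, hg, comp_zero])
  have h2 : j ≫ g = 0 := ha.hom_eq_zero (fun r hr s hs => by
    have := hr.2
    have := hs.2
    simp only [Set.mem_Ici] at *
    lia) hR hA _
  rw [← Category.id_comp g, ← hs, Preadditive.add_comp, Category.assoc, Category.assoc, h1, h2,
    comp_zero, comp_zero, add_zero]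

lemma IsGrading.epiOn_last (ha : IsGrading S a) (m : ℕ) {A B : T} {f : A ⟶ B}
    (hB : Supp a (Set.Icc 0 (m : ℤ)) B)
    (hf : ∀ Z, Supp a (Set.Icc 0 (m : ℤ)) Z → ∀ g : B ⟶ Z, f ≫ g = 0 → g = 0) :
    EpiOn a m f := by
  intro Z hZ g hg
  obtain ⟨L, R, i, p, j, r, hL, hR, hip, hjr, hs⟩ := ha.isSumOf (-1) hZ
  have h1 := hf R (hR.mono fun x hx => ⟨by simpa using hx.2, hx.1⟩) (g ≫ r) (by
    rw [← Category.assoc, hg, zero_comp])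
  have h2 : g ≫ p = 0 := ha.hom_eq_zero (fun r hr s hs => by
    have := hr.1
    have := hs.2
    simp only [Set.mem_Iic] at *
    lia) hB hL _
  rw [← Category.comp_id g, ← hs, Preadditive.comp_add, ← Category.assoc, ← Category.assoc, h1, h2,
    zero_comp, zero_comp, add_zero]

variable (𝒜 : Angulation S n)

/-- The sequence obtained by rotating an angle to the left. -/
lemma exists_isRightExtension (hn : 1 ≤ n) (ha : IsGrading S a) (m : ℕ) {d : ℕ}
    (hd : d + 2 = (n + 2) * (m + 1)) {A B : T} {f : A ⟶ B}
    (hA : Supp a (Set.Icc 0 (m : ℤ)) A) {X : SSeq S n} (hX : 𝒜.IsAngle X)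
    (e : Arrow.mk (X.d 0) ≅ Arrow.mk f)
    (hsupp : ∀ (i : ℕ) (_ : i ≤ n + 1), Supp a (Set.Ici 0) (X.obj i)) :
    ∃ (Q : ℕ → T) (q : ∀ i, Q i ⟶ Q (i + 1)),
      IsRightExtension (Supp a (Set.Icc 0 (m : ℤ))) (Supp a (Set.Ici ((m : ℤ) + 1))) d f Q q := by
  let R : ℕ → SSeq S n := fun k => Nat.rec X (fun _ Y => (exists_isRotation Y).choose) k
  have hR : ∀ k, (R k).IsRotation (R (k + 1)) := fun k => (exists_isRotation (R k)).choose_spec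
  have hangle : ∀ k, 𝒜.IsAngle (R k) := fun k => by
    induction k with
    | zero => exact hX
    | succ k ih => exact (𝒜.rotation_iff _ _ (hR k)).1 ih
  -- Term `i` of the `k`-th rotation is the term at position `k + i` of the long sequence; the
  -- quotient counts the suspensions applied so far.
  have hRsupp : ∀ (k i : ℕ) (_ : i ≤ n + 1),
      Supp a (Set.Ici (((k + i) / (n + 2) : ℕ) : ℤ)) ((R k).obj i) := by
    intro k
    induction k with
    | zero =>
      intro i hi
      rw [Nat.div_eq_of_lt (by lia)]
      exact hsupp i hi
    | succ k ih =>
      intro i hi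
      obtain ⟨e, e', -⟩ := hR k
      obtain hi' | rfl : i ≤ n ∨ i = n + 1 := by lia
      · have := (ih (i + 1) (by lia)).of_iso (e i hi').symm
        rwa [show k + (i + 1) = k + 1 + i by ring] at this
      · refine (ha.supp_map (ih 0 (by lia)) fun r hr => ?_).of_iso e'.symm
        rw [show k + 1 + (n + 1) = k + (n + 2) by ring, Nat.add_div_right _ (by lia)]
        simp only [Set.mem_Ici, add_zero] at hr ⊢
        push_cast
        lia
  have hex := hR
  choose ε ε' h₁ h₂ h₃ using hex
  let q : ∀ k, (R k).obj 0 ⟶ (R (k + 1)).obj 0 := fun k =>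
    (R k).d 0 ≫ (ε k 0 n.zero_le).inv
  have hq : ∀ k, q k ≫ (ε k 0 n.zero_le).hom = (R k).d 0 := fun k => by simp [q]
  have hq' : ∀ k, (ε k 0 n.zero_le).hom ≫ (R k).d 1 hn =
      q (k + 1) ≫ (ε (k + 1) 0 n.zero_le).hom ≫ (ε k 1 hn).hom := fun k => by
    rw [← h₁ k 0 hn, ← hq (k + 1), Category.assoc]
  have hqiso : ∀ k, Nonempty (Arrow.mk (q k) ≅ Arrow.mk ((R k).d 0)) := fun k =>
    ⟨Arrow.isoMk' _ _ (Iso.refl _) (ε k 0 n.zero_le) (by rw [hq]; exact Category.id_comp _)⟩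
  have hqq : ∀ k, q k ≫ q (k + 1) = 0 := fun k => by
    have h := 𝒜.comp_eq_zero hn (hangle k)
    rw [← hq k, Category.assoc, hq' k, ← Category.assoc] at h
    rwa [← zero_comp (f := (ε (k + 1) 0 n.zero_le).hom ≫ (ε k 1 hn).hom), cancel_mono] at h
  refine ⟨fun k => (R k).obj 0, q, ⟨⟨(hqiso 0).some ≪≫ e⟩, hqq, ?_, ?_, ?_, ?_, ?_⟩⟩
  · intro k Y h w
    obtain ⟨g, hg⟩ := 𝒜.exists_desc hn (hangle k) ((ε k 0 n.zero_le).inv ≫ h) (by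
      rw [← Category.assoc]; exact w)
    refine ⟨((ε (k + 1) 0 n.zero_le).hom ≫ (ε k 1 hn).hom) ≫ g, ?_⟩
    rw [← Category.assoc, ← hq', Category.assoc, hg, Iso.hom_inv_id_assoc]
  · intro k Y y w
    obtain ⟨z, hz⟩ := 𝒜.exists_lift hn (hangle k) (y ≫ (ε k 0 n.zero_le).hom) (by
      rw [Category.assoc, hq', ← Category.assoc, w, zero_comp])
    refine ⟨z, ?_⟩
    simp only [q]
    rw [← Category.assoc, hz, Category.assoc, Iso.hom_inv_id, Category.comp_id]
  · intro k
    obtain ⟨L, Z, i, p, j, r, hL, hZ, h⟩ := ha.isSumOf m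
      ((hRsupp k 0 (by lia)).mono (J := Set.Ici 0) (Set.Ici_subset_Ici.2 (by positivity)))
    exact ⟨L, Z, i, p, j, r, hL.mono fun x hx => ⟨hx.1, hx.2⟩, hZ.mono fun x hx => hx.2, h⟩
  · have := hRsupp (d + 2) 0 (by lia)
    have h : ((d + 2 + 0) / (n + 2) : ℕ) = m + 1 := by
      rw [add_zero, hd, Nat.mul_div_cancel_left _ (by lia)]
    rw [h] at this
    exact_mod_cast this
  · intro hf Z hZ g
    -- Up to isomorphism, `q ((n + 2) * k)` is `f` suspended `k` times. At `k = m + 1` this is `q (d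
    -- + 2)`, and `q (d + 1) ≫ q (d + 2) = 0` then yields the claim.
    have key : ∀ k : ℕ, MonoOn a k (q ((n + 2) * k)) := by
      intro k
      induction k with
      | zero => exact (ha.monoOn_zero m hA hf).of_iso ((hqiso 0).some ≪≫ e).symm
      | succ k ih =>
        obtain ⟨e₁⟩ := arrow_iso_of_rotations (fun l => R ((n + 2) * k + l)) (fun l _ => hR _)
        have := (ha.monoOn_map (ih.of_iso (hqiso _).some)).of_iso e₁.symm
        exact this.of_iso (hqiso ((n + 2) * k + (n + 2))).some.symm
    have h1 := key (m + 1)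
    rw [← hd] at h1
    exact h1 Z (by exact_mod_cast hZ) _ (by
      rw [Category.assoc]
      exact (congrArg (g ≫ ·) (hqq (d + 1))).trans comp_zero)

/-- The sequence in the opposite category obtained by rotating an angle to the right. -/
lemma exists_isRightExtension_op (hn : 1 ≤ n) (ha : IsGrading S a) (m : ℕ) {d : ℕ}
    (hd : d + 2 = (n + 2) * (m + 1)) {A B : T} {f : A ⟶ B}
    (hA : Supp a (Set.Icc 0 (m : ℤ)) A) (hB : Supp a (Set.Icc 0 (m : ℤ)) B)
    {X : SSeq S n} (hX : 𝒜.IsAngle X) (e : Arrow.mk (X.d 0) ≅ Arrow.mk f)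
    (hsupp : ∀ (i : ℕ) (_ : i ≤ n + 1), Supp a (Set.Iic ((m : ℤ) + 1)) (X.obj i)) :
    ∃ (Q : ℕ → Tᵒᵖ) (q : ∀ i, Q i ⟶ Q (i + 1)),
      IsRightExtension (Supp a (Set.Icc 0 (m : ℤ))).op (Supp a (Set.Iic (-1))).op d f.op Q q := by
  let R : ℕ → SSeq S n := fun k => Nat.rec X (fun _ Y => (exists_isRotation_left Y).choose) k
  have hR : ∀ k, (R (k + 1)).IsRotation (R k) := fun k =>
    (exists_isRotation_left (R k)).choose_spec
  have hangle : ∀ k, 𝒜.IsAngle (R k) := fun k => by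
    induction k with
    | zero => exact hX
    | succ k ih => exact (𝒜.rotation_iff _ _ (hR k)).2 ih
  -- Term `i` of the `k`-th left rotation lies `k + 1 - i` places to the left of `B`. Integer
  -- division rounds down, so for `k = 0` the bound is `m` on `A` and `B` and `m + 1` on the later
  -- terms.
  have hRsupp : ∀ (k i : ℕ) (_ : i ≤ n + 1),
      Supp a (Set.Iic ((m : ℤ) - ((k : ℤ) + 1 - i) / ((n : ℤ) + 2))) ((R k).obj i) := by
    intro k
    induction k with
    | zero =>
      intro i hi
      obtain hi' | hi' : i ≤ 1 ∨ 2 ≤ i := by lia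
      · rw [Int.ediv_eq_zero_of_lt (by lia) (by lia), sub_zero]
        obtain rfl | rfl : i = 0 ∨ i = 1 := by lia
        · exact (hA.of_iso (Arrow.leftFunc.mapIso e).symm).mono fun x hx => hx.2
        · exact (hB.of_iso (Arrow.rightFunc.mapIso e).symm).mono fun x hx => hx.2
      · have : (((0 : ℕ) : ℤ) + 1 - i) / ((n : ℤ) + 2) = -1 := by
          rw [Int.ediv_eq_iff_of_pos (by lia)]
          constructor <;> lia
        rw [this, sub_neg_eq_add]
        exact hsupp i hi
    | succ k ih =>
      intro i hi
      obtain ⟨e, e', -⟩ := hR k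
      obtain rfl | ⟨i, rfl⟩ : i = 0 ∨ ∃ i', i = i' + 1 := by
        cases i
        · exact Or.inl rfl
        · exact Or.inr ⟨_, rfl⟩
      · refine ha.supp_of_map ((ih (n + 1) le_rfl).of_iso e') fun r hr => ?_
        have : ((k : ℤ) + 1 - ((n + 1 : ℕ) : ℤ)) / ((n : ℤ) + 2) =
            (((k + 1 : ℕ) : ℤ) + 1 - ((0 : ℕ) : ℤ)) / ((n : ℤ) + 2) - 1 := by
          rw [show (((k + 1 : ℕ) : ℤ) + 1 - ((0 : ℕ) : ℤ)) =
              ((k : ℤ) + 1 - ((n + 1 : ℕ) : ℤ)) + 1 * ((n : ℤ) + 2) by push_cast; ring,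
            Int.add_mul_ediv_right _ _ (by lia)]
          ring
        rw [this] at hr
        simp only [Set.mem_Iic] at hr ⊢
        lia
      · have := (ih i (by lia)).of_iso (e i (by lia))
        rwa [show (k : ℤ) + 1 - (i : ℤ) = ((k + 1 : ℕ) : ℤ) + 1 - ((i + 1 : ℕ) : ℤ) by
          push_cast; ring] at this
  have hex := hR
  choose ε ε' h₁ h₂ h₃ using hex
  -- Terms with index 1 are used so that the opposite sequence starts with `B`, followed by a copy
  -- of `A`.
  let q : ∀ k, (R (k + 1)).obj 1 ⟶ (R k).obj 1 := fun k =>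
    (ε k 0 n.zero_le).inv ≫ (R k).d 0
  have hq' : ∀ k, q k ≫ (ε k 1 hn).hom = (R (k + 1)).d 1 hn := fun k => by
    simp only [q, Category.assoc]
    rw [h₁ k 0 hn, Iso.inv_hom_id_assoc]
  have hqiso : ∀ k, Nonempty (Arrow.mk (q k) ≅ Arrow.mk ((R k).d 0)) := fun k =>
    ⟨Arrow.isoMk' _ _ (ε k 0 n.zero_le).symm (Iso.refl _) (Category.comp_id _).symm⟩
  have hqq : ∀ k, q (k + 1) ≫ q k = 0 := fun k => by
    rw [← cancel_mono (ε k 1 hn).hom, Category.assoc, hq']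
    simp only [q, Category.assoc]
    rw [𝒜.comp_eq_zero hn (hangle (k + 1)), comp_zero, zero_comp]
  refine ⟨fun k => .op ((R k).obj 1), fun k => (q k).op,
    ⟨⟨?_⟩, fun k => congrArg Quiver.Hom.op (hqq k), ?_, ?_, ?_, ?_, ?_⟩⟩
  · let e₁ := (hqiso 0).some ≪≫ e
    exact Arrow.isoMk' _ _ (Arrow.rightFunc.mapIso e₁).symm.op (Arrow.leftFunc.mapIso e₁).symm.op
      (congrArg Quiver.Hom.op e₁.inv.w.symm)
  · intro k Y h w
    obtain ⟨z, hz⟩ := 𝒜.exists_lift hn (hangle (k + 1)) h.unop (by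
      rw [← hq', ← Category.assoc, show h.unop ≫ q k = 0 from congrArg Quiver.Hom.unop w,
        zero_comp])
    refine ⟨(z ≫ (ε (k + 1) 0 n.zero_le).hom).op, Quiver.Hom.unop_inj ?_⟩
    change (z ≫ (ε (k + 1) 0 n.zero_le).hom) ≫ q (k + 1) = h.unop
    simp only [q, Category.assoc]
    rw [Iso.hom_inv_id_assoc, hz]
  · intro k Y y w
    obtain ⟨g, hg⟩ := 𝒜.exists_desc hn (hangle (k + 1)) y.unop (by
      have : q (k + 1) ≫ y.unop = 0 := congrArg Quiver.Hom.unop w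
      simp only [q, Category.assoc] at this
      rwa [← comp_zero (f := (ε (k + 1) 0 n.zero_le).inv), cancel_epi] at this)
    refine ⟨((ε k 1 hn).hom ≫ g).op, Quiver.Hom.unop_inj ?_⟩
    change q k ≫ (ε k 1 hn).hom ≫ g = y.unop
    rw [← Category.assoc, hq', hg]
  · intro k
    have hk : Supp a (Set.Iic (m : ℤ)) ((R k).obj 1) := (hRsupp k 1 (by lia)).mono
      (Set.Iic_subset_Iic.2 (by
        have : 0 ≤ ((k : ℤ) + 1 - ((1 : ℕ) : ℤ)) / ((n : ℤ) + 2) :=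
          Int.ediv_nonneg (by lia) (by lia)
        lia))
    obtain ⟨L, Z, i, p, j, r, hL, hZ, h⟩ := ha.isSumOf (-1) hk
    have hL' : Supp a (Set.Iic (-1)) L := hL.mono fun x hx => hx.2
    have hZ' : Supp a (Set.Icc 0 (m : ℤ)) Z := hZ.mono fun x hx => ⟨by simpa using hx.2, hx.1⟩
    exact IsSumOf.op (IsSumOf.symm ⟨L, Z, i, p, j, r, hL', hZ', h⟩)
  · have := hRsupp (d + 2) 1 (by lia)
    have h2 : (((d + 2 : ℕ) : ℤ) + 1 - ((1 : ℕ) : ℤ)) / ((n : ℤ) + 2) = (m : ℤ) + 1 := by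
      rw [hd]
      push_cast
      rw [show ((n : ℤ) + 2) * (m + 1) + 1 - 1 = ((n : ℤ) + 2) * (m + 1) by ring,
        Int.mul_ediv_cancel_left _ (by lia)]
    rw [h2] at this
    exact this.mono (Set.Iic_subset_Iic.2 (by lia))
  · intro hf Z hZ g
    have hf' : ∀ Z, Supp a (Set.Icc 0 (m : ℤ)) Z → ∀ g : B ⟶ Z, f ≫ g = 0 → g = 0 :=
      fun Z hZ g hg => Quiver.Hom.op_inj (hf (.op Z) hZ g.op (congrArg Quiver.Hom.op hg))
    -- Here `q ((n + 2) * k)` is `f` desuspended `k` times, so the test degrees fall by one with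
    -- each block, reaching `-1` at `k = m + 1`.
    have key : ∀ k : ℕ, EpiOn a ((m : ℤ) - k) (q ((n + 2) * k)) := by
      intro k
      induction k with
      | zero =>
        have := (ha.epiOn_last m hB hf').of_iso ((hqiso 0).some ≪≫ e).symm
        simpa using this
      | succ k ih =>
        obtain ⟨e₁⟩ := arrow_iso_of_left_rotations R hR ((n + 2) * k)
        have h1 := ih.of_iso (hqiso _).some
        have := (ha.epiOn_of_map (h1.of_iso e₁)).of_iso (hqiso ((n + 2) * k + (n + 2))).some.symm
        rw [show (m : ℤ) - ((k + 1 : ℕ) : ℤ) = (m : ℤ) - k - 1 by push_cast; ring]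
        exact this
    have h1 := key (m + 1)
    rw [← hd] at h1
    refine Quiver.Hom.unop_inj (h1 _ (hZ.mono (Set.Iic_subset_Iic.2 (by lia))) _ ?_)
    have : q (d + 2) ≫ q (d + 1) = 0 := hqq _
    change q (d + 2) ≫ q (d + 1) ≫ g.unop = 0
    rw [← Category.assoc, this, zero_comp]

end Rotations

/-! ### Splitting idempotents -/

section Idempotents

variable {T : Type u} [Category.{v} T]

/-- All idempotent endomorphisms of `X` split. -/
def IdempotentsSplit (X : T) : Prop :=
  ∀ e : X ⟶ X, e ≫ e = e → ∃ (Y : T) (i : Y ⟶ X) (p : X ⟶ Y), i ≫ p = 𝟙 Y ∧ p ≫ i = e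

lemma IdempotentsSplit.of_iso {X Y : T} (hX : IdempotentsSplit X) (α : X ≅ Y) :
    IdempotentsSplit Y := fun e he => by
  obtain ⟨Z, i, p, hip, hpi⟩ := hX (α.hom ≫ e ≫ α.inv) (by
    simp only [Category.assoc, Iso.inv_hom_id_assoc]
    rw [← Category.assoc e e, he])
  refine ⟨Z, i ≫ α.hom, α.inv ≫ p, by simp [hip], ?_⟩
  rw [Category.assoc, ← Category.assoc p, hpi]
  simp

lemma IdempotentsSplit.map {X : T} (hX : IdempotentsSplit X) (F : T ≌ T) :
    IdempotentsSplit (F.functor.obj X) := fun e he => by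
  obtain ⟨e, rfl⟩ := F.functor.map_surjective e
  obtain ⟨Z, i, p, hip, hpi⟩ := hX e (F.functor.map_injective (by
    rw [CategoryTheory.Functor.map_comp, he]))
  exact ⟨F.functor.obj Z, F.functor.map i, F.functor.map p,
    by rw [← CategoryTheory.Functor.map_comp, hip, CategoryTheory.Functor.map_id],
    by rw [← CategoryTheory.Functor.map_comp, hpi]⟩

variable [Preadditive T]

lemma IdempotentsSplit.of_id_eq_zero {X : T} (hX : 𝟙 X = 0) : IdempotentsSplit X := fun e _ =>
  ⟨X, 𝟙 X, 𝟙 X, Category.comp_id _, by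
    rw [← Category.comp_id e, hX, comp_zero, comp_zero]⟩

variable [HasFiniteBiproducts T]

/-- As there are no morphisms `R ⟶ L`, the idempotent is triangular, with idempotent diagonal
entries `α`, `γ` and corner `β = α ≫ β + β ≫ γ`. Splittings of `α` and `γ` combine to one of `e`:
the inclusion carries the part `α ≫ β` of the corner and the projection the part `β ≫ γ`. They are
compatible because `α ≫ β ≫ γ = 0`. -/
lemma IdempotentsSplit.of_isSumOf {C U : ObjectProperty T} {X : T} (hX : IsSumOf C U X)
    (hC : ∀ L, C L → IdempotentsSplit L) (hU : ∀ R, U R → IdempotentsSplit R)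
    (hUC : ∀ R L, U R → C L → ∀ g : R ⟶ L, g = 0) : IdempotentsSplit X := by
  obtain ⟨L, R, i, p, j, r, hL, hR, hip, hjr, hs⟩ := hX
  intro e he
  have hjep : j ≫ e ≫ p = 0 := hUC _ _ hR hL _
  have hjp : j ≫ p = 0 := hUC _ _ hR hL _
  have hmid : ∀ {Y Z : T} (x : Y ⟶ X) (y : X ⟶ Z), x ≫ y = (x ≫ p) ≫ i ≫ y + (x ≫ r) ≫ j ≫ y :=
    fun x y => by
      rw [Category.assoc, Category.assoc, ← Category.assoc p, ← Category.assoc r,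
        ← Preadditive.comp_add, ← Preadditive.add_comp, hs, Category.id_comp]
  have hir : i ≫ r = 0 := by
    have := hmid i r
    rw [hip, hjr, Category.id_comp, Category.comp_id] at this
    exact add_eq_left.1 this.symm
  obtain ⟨α, hα⟩ : ∃ α, α = i ≫ e ≫ p := ⟨_, rfl⟩
  obtain ⟨β, hβ⟩ : ∃ β, β = i ≫ e ≫ r := ⟨_, rfl⟩
  obtain ⟨γ, hγ⟩ : ∃ γ, γ = j ≫ e ≫ r := ⟨_, rfl⟩
  have hee : ∀ {Z : T} (x : X ⟶ Z), e ≫ e ≫ x = e ≫ x := fun x => by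
    rw [← Category.assoc, he]
  have hjep' : ∀ {Z : T} (x : L ⟶ Z), j ≫ e ≫ p ≫ x = 0 := fun x => by
    rw [← Category.assoc e, ← Category.assoc, hjep, zero_comp]
  have hαα : α ≫ α = α := by
    have := hmid (i ≫ e) (e ≫ p)
    simp only [Category.assoc, hee, hjep, comp_zero, add_zero] at this
    simpa only [hα, Category.assoc] using this.symm
  have hγγ : γ ≫ γ = γ := by
    have := hmid (j ≫ e) (e ≫ r)
    simp only [Category.assoc, hee, hjep', zero_add] at this
    simpa only [hγ, Category.assoc] using this.symm
  have hβ' : α ≫ β + β ≫ γ = β := by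
    have := hmid (i ≫ e) (e ≫ r)
    simp only [Category.assoc, hee] at this
    simpa only [hα, hβ, hγ, Category.assoc] using this.symm
  have hαβγ : α ≫ β ≫ γ = 0 := by
    have := congrArg (fun x => α ≫ x) hβ'
    simp only [Preadditive.comp_add] at this
    rw [← Category.assoc α α, hαα] at this
    exact add_eq_left.1 this
  have he' : e = p ≫ α ≫ i + p ≫ β ≫ j + r ≫ γ ≫ j := by
    calc e = (p ≫ i + r ≫ j) ≫ e ≫ (p ≫ i + r ≫ j) := by
          rw [hs, Category.comp_id, Category.id_comp]
      _ = p ≫ (i ≫ e ≫ p) ≫ i + p ≫ (i ≫ e ≫ r) ≫ j +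
          (r ≫ (j ≫ e ≫ p) ≫ i + r ≫ (j ≫ e ≫ r) ≫ j) := by
        simp only [Preadditive.add_comp, Preadditive.comp_add, Category.assoc]
        abel
      _ = _ := by rw [hjep, ← hα, ← hβ, ← hγ, zero_comp, comp_zero, zero_add]
  obtain ⟨P, u, v, huv, hvu⟩ := hC L hL α hαα
  obtain ⟨N, u', v', huv', hvu'⟩ := hU R hR γ hγγ
  have hz : u ≫ β ≫ v' = 0 := by
    have h1 : u = u ≫ α := by rw [← hvu, ← Category.assoc, huv, Category.id_comp]
    have h2 : v' = γ ≫ v' := by rw [← hvu', Category.assoc, huv', Category.comp_id]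
    rw [h1, h2, Category.assoc, ← Category.assoc β, ← Category.assoc α, hαβγ, zero_comp, comp_zero]
  refine ⟨P ⊞ N, biprod.desc (u ≫ i + u ≫ β ≫ j) (u' ≫ j),
    biprod.lift (p ≫ v) (p ≫ β ≫ v' + r ≫ v'), ?_, ?_⟩
  · have hip' : ∀ {Z : T} (x : L ⟶ Z), i ≫ p ≫ x = x := fun x => by
      rw [← Category.assoc, hip, Category.id_comp]
    have hjr' : ∀ {Z : T} (x : R ⟶ Z), j ≫ r ≫ x = x := fun x => by
      rw [← Category.assoc, hjr, Category.id_comp]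
    have hir' : ∀ {Z : T} (x : R ⟶ Z), i ≫ r ≫ x = 0 := fun x => by
      rw [← Category.assoc, hir, zero_comp]
    have hjp' : ∀ {Z : T} (x : L ⟶ Z), j ≫ p ≫ x = 0 := fun x => by
      rw [← Category.assoc, hjp, zero_comp]
    apply biprod.hom_ext' <;> apply biprod.hom_ext <;>
      simp [hip', hjr', hir', hjp', huv, huv', hz]
  · rw [biprod.lift_desc, he', ← hvu, ← hvu']
    have h3 : p ≫ v ≫ u ≫ β ≫ j + p ≫ β ≫ v' ≫ u' ≫ j = p ≫ β ≫ j := by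
      rw [← Preadditive.comp_add, ← Category.assoc v, hvu, ← Category.assoc v', hvu',
        ← Category.assoc, ← Category.assoc β, ← Preadditive.add_comp, hβ']
    simp only [Preadditive.comp_add, Preadditive.add_comp, Category.assoc]
    rw [← h3]
    abel

variable {S : T ≌ T} {a : ℤ → ObjectProperty T}

lemma IsGrading.idempotentsSplit (ha : IsGrading S a)
    (h : ∀ j x, a j x → IdempotentsSplit x) (k : ℕ) {t : T} (ht : Supp a (Set.Icc 0 (k : ℤ)) t) :
    IdempotentsSplit t := by
  have base : ∀ (k : ℤ) {t : T}, Supp a {k} t → IdempotentsSplit t := by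
    intro k t ht
    obtain ⟨κ, x, hx, hx0, ⟨e⟩⟩ := ha.exists_finite_sum ht
    refine IdempotentsSplit.of_iso ?_ e.symm
    by_cases hk : k ∈ κ
    · refine (h _ _ (hx ⟨k, hk⟩)).of_iso ⟨biproduct.ι x _, biproduct.π x _, by simp, ?_⟩
      rw [← biproduct.total, Finset.sum_eq_single ⟨k, hk⟩]
      · intro l _ hl
        rw [← Category.id_comp (biproduct.ι x l), hx0 l fun h' => hl (Subtype.ext h'), zero_comp,
          comp_zero]
      · exact fun h' => absurd (Finset.mem_univ _) h'
    · refine IdempotentsSplit.of_id_eq_zero ?_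
      rw [← biproduct.total]
      refine Finset.sum_eq_zero fun l _ => ?_
      rw [← Category.id_comp (biproduct.ι x l), hx0 l fun h' => hk (h' ▸ l.2), zero_comp,
        comp_zero]
  induction k generalizing t with
  | zero => exact base 0 (ht.mono fun x hx => le_antisymm hx.2 hx.1)
  | succ k ih =>
    refine IdempotentsSplit.of_isSumOf (ha.isSumOf k ht) (fun L hL => ih (hL.mono fun x hx =>
      ⟨hx.1.1, hx.2⟩)) (fun R hR => base (k + 1) (hR.mono fun x hx => ?_)) fun R L hR hL g =>
      ha.hom_eq_zero (fun r hr s hs => ?_) hR hL g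
    · exact le_antisymm (by simpa using hx.1.2) hx.2
    · have := hr.2
      have := hs.2
      simp only [Set.mem_Iic, Set.mem_Ici] at *
      lia

lemma Supp.isClosedUnderFiniteProducts (a : ℤ → ObjectProperty T) (I : Set ℤ) :
    (Supp a I).IsClosedUnderFiniteProducts where
  isClosedUnderLimitsOfShape J _ :=
    { limitsOfShape_le := by
        rintro X ⟨p⟩
        have := Fintype.ofFinite J
        let e : X ≅ ⨁ (p.diag.obj ∘ Discrete.mk) :=
          IsLimit.conePointsIsoOfNatIso p.isLimit (biproduct.isLimit (p.diag.obj ∘ Discrete.mk))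
            Discrete.natIsoFunctor
        refine Supp.of_iso ?_ e.symm
        exact Supp.of_sum (p.diag.obj ∘ Discrete.mk) (fun l => p.prop_diag_obj _)
          (fun l => biproduct.π _ l) (fun l => biproduct.ι _ l) biproduct.total }

end Idempotents

/-! ### The truncated subcategories are `d`-abelian -/

section FullSubcategory

variable {T : Type u} [Category.{v} T] [Preadditive T] {P : ObjectProperty T} {d : ℕ}

lemma isDCokernelOn_ι_iff (X : ComposableArrows P.FullSubcategory (d + 1)) :
    IsDCokernelOn P (X ⋙ P.ι) ↔ IsDCokernel X := by
  constructor
  · intro h Y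
    obtain ⟨h₁, h₂⟩ := h Y.obj Y.property
    refine ⟨fun g g' w => ObjectProperty.hom_ext _ (h₁ (congrArg (fun x => x.hom) w)),
      fun i hi g => ⟨fun w => ?_, ?_⟩⟩
    · obtain ⟨z, hz⟩ := (h₂ i hi g.hom).1 (congrArg (fun x => x.hom) w)
      exact ⟨ObjectProperty.homMk z, ObjectProperty.hom_ext _ hz⟩
    · rintro ⟨z, hz⟩
      exact ObjectProperty.hom_ext _ ((h₂ i hi g.hom).2 ⟨z.hom, congrArg (fun x => x.hom) hz⟩)
  · intro h Y hY
    obtain ⟨h₁, h₂⟩ := h ⟨Y, hY⟩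
    refine ⟨fun g g' w => congrArg (fun x => x.hom)
      (h₁ (a₁ := ObjectProperty.homMk g) (a₂ := ObjectProperty.homMk g')
        (ObjectProperty.hom_ext _ w)), fun i hi g => ⟨fun w => ?_, ?_⟩⟩
    · obtain ⟨z, hz⟩ := (h₂ i hi (ObjectProperty.homMk g)).1 (ObjectProperty.hom_ext _ w)
      exact ⟨z.hom, congrArg (fun x => x.hom) hz⟩
    · rintro ⟨z, hz⟩
      exact congrArg (fun x => x.hom) ((h₂ i hi (ObjectProperty.homMk g)).2
        ⟨ObjectProperty.homMk z, ObjectProperty.hom_ext _ hz⟩)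

lemma isDKernelOn_ι_iff (X : ComposableArrows P.FullSubcategory (d + 1)) :
    IsDKernelOn P (X ⋙ P.ι) ↔ IsDKernel X := by
  constructor
  · intro h Y
    obtain ⟨h₁, h₂⟩ := h Y.obj Y.property
    refine ⟨fun g g' w => ObjectProperty.hom_ext _ (h₁ (congrArg (fun x => x.hom) w)),
      fun i hi g => ⟨fun w => ?_, ?_⟩⟩
    · obtain ⟨z, hz⟩ := (h₂ i hi g.hom).1 (congrArg (fun x => x.hom) w)
      exact ⟨ObjectProperty.homMk z, ObjectProperty.hom_ext _ hz⟩
    · rintro ⟨z, hz⟩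
      exact ObjectProperty.hom_ext _ ((h₂ i hi g.hom).2 ⟨z.hom, congrArg (fun x => x.hom) hz⟩)
  · intro h Y hY
    obtain ⟨h₁, h₂⟩ := h ⟨Y, hY⟩
    refine ⟨fun g g' w => congrArg (fun x => x.hom)
      (h₁ (a₁ := ObjectProperty.homMk g) (a₂ := ObjectProperty.homMk g')
        (ObjectProperty.hom_ext _ w)), fun i hi g => ⟨fun w => ?_, ?_⟩⟩
    · obtain ⟨z, hz⟩ := (h₂ i hi (ObjectProperty.homMk g)).1 (ObjectProperty.hom_ext _ w)
      exact ⟨z.hom, congrArg (fun x => x.hom) hz⟩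
    · rintro ⟨z, hz⟩
      exact congrArg (fun x => x.hom) ((h₂ i hi (ObjectProperty.homMk g)).2
        ⟨ObjectProperty.homMk z, ObjectProperty.hom_ext _ hz⟩)

end FullSubcategory

/-! ### Construction of `d`-kernels and `d`-cokernels, and the `d`-abelian axioms -/

section Main

variable {T : Type u} [Category.{v} T] [Preadditive T] [HasFiniteBiproducts T] {S : T ≌ T}
  {a : ℤ → ObjectProperty T} {n : ℕ}

namespace IsGrading

/-- Closure under `n`-extensions gives an angle on `f` whose terms are in degrees `0, …, m + 1`. -/
lemma exists_angle_supp (ha : IsGrading S a) (𝒜 : Angulation S n) (m : ℕ)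
    (hExt : IsClosedUnderNExtensions 𝒜 (Supp a (Set.Icc 0 ((m : ℤ) + 1)))) {A B : T} (f : A ⟶ B)
    (hA : Supp a (Set.Icc 0 (m : ℤ)) A) (hB : Supp a (Set.Icc 0 (m : ℤ)) B) :
    ∃ X : SSeq S n, 𝒜.IsAngle X ∧ Nonempty (Arrow.mk (X.d 0) ≅ Arrow.mk f) ∧
      ∀ (i : ℕ) (_ : i ≤ n + 1), Supp a (Set.Icc 0 ((m : ℤ) + 1)) (X.obj i) := by
  have hle : Set.Icc 0 (m : ℤ) ⊆ Set.Icc 0 ((m : ℤ) + 1) := Set.Icc_subset_Icc_right (by lia)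
  have hSA : Supp a (Set.Icc 0 ((m : ℤ) + 1)) (S.functor.obj A) :=
    ha.supp_map hA fun r hr => ⟨by have := hr.1; lia, by have := hr.2; lia⟩
  -- Closure under extensions prescribes the last morphism of an angle, so it is applied to `S f`; a
  -- left rotation turns this into a first morphism `f`. The object `S A` reaches degree `m + 1`,
  -- which is why closure is needed there.
  obtain ⟨Y, e₀, e₁, hY, hconn, hYi⟩ := hExt B (S.functor.obj A) (S.functor.map f) (hB.mono hle) hSA
  obtain ⟨X, hX⟩ := exists_isRotation_left Y
  obtain ⟨ec⟩ := hX.arrow_iso_conn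
  have hX' := (𝒜.rotation_iff _ _ hX).2 hY
  obtain ⟨e, e', -⟩ := hX
  let es : Arrow.mk (S.functor.map (X.d 0)) ≅ Arrow.mk (S.functor.map f) :=
    ec.symm ≪≫ Arrow.isoMk' _ _ e₁ (S.functor.mapIso e₀) hconn.symm
  let l : X.obj 0 ≅ A := S.functor.preimageIso (Arrow.leftFunc.mapIso es)
  let r : X.obj 1 ≅ B := S.functor.preimageIso (Arrow.rightFunc.mapIso es)
  have hl : S.functor.map l.hom = es.hom.left := S.functor.map_preimage _
  have hr : S.functor.map r.hom = es.hom.right := S.functor.map_preimage _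
  refine ⟨X, hX', ⟨Arrow.isoMk' _ _ l r (S.functor.map_injective ?_)⟩, fun i hi => ?_⟩
  · rw [CategoryTheory.Functor.map_comp, CategoryTheory.Functor.map_comp, hl, hr]
    exact es.hom.w
  · obtain rfl | ⟨i, rfl⟩ : i = 0 ∨ ∃ i', i = i' + 1 := by
      cases i
      · exact Or.inl rfl
      · exact Or.inr ⟨_, rfl⟩
    · exact (hA.mono hle).of_iso l.symm
    · refine Supp.of_iso ?_ (e i (by lia))
      obtain rfl | hi' : i = 0 ∨ 1 ≤ i := by lia
      · exact (hB.mono hle).of_iso e₀.symm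
      · exact hYi i hi' (by lia)

lemma exists_dCokernelOn (ha : IsGrading S a) (𝒜 : Angulation S n) (hn : 1 ≤ n) (m : ℕ)
    (hExt : IsClosedUnderNExtensions 𝒜 (Supp a (Set.Icc 0 ((m : ℤ) + 1)))) {d : ℕ}
    (hd : d + 2 = (n + 2) * (m + 1)) {A B : T} (f : A ⟶ B)
    (hA : Supp a (Set.Icc 0 (m : ℤ)) A) (hB : Supp a (Set.Icc 0 (m : ℤ)) B) :
    ∃ P : ComposableArrows T (d + 1), (∀ i, Supp a (Set.Icc 0 (m : ℤ)) (P.obj i)) ∧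
      Nonempty (Arrow.mk (P.map' 0 1) ≅ Arrow.mk f) ∧
      IsDCokernelOn (Supp a (Set.Icc 0 (m : ℤ))) P ∧
      ((∀ Z, Supp a (Set.Icc 0 (m : ℤ)) Z → ∀ g : Z ⟶ A, g ≫ f = 0 → g = 0) →
        IsDKernelOn (Supp a (Set.Icc 0 (m : ℤ))) P) := by
  obtain ⟨X, hX, ⟨e⟩, hXi⟩ := ha.exists_angle_supp 𝒜 m hExt f hA hB
  obtain ⟨Q, q, h⟩ := exists_isRightExtension 𝒜 hn ha m hd hA hX e
    fun i hi => (hXi i hi).mono fun x hx => hx.1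
  refine h.exists_isDCokernelOn (fun Z Y hZ hY g => ha.hom_eq_zero (fun r hr s hs => ?_) hZ hY g)
    hA hB
  have := hs.2
  simp only [Set.mem_Ici] at hr
  lia

lemma exists_dKernelOn (ha : IsGrading S a) (𝒜 : Angulation S n) (hn : 1 ≤ n) (m : ℕ)
    (hExt : IsClosedUnderNExtensions 𝒜 (Supp a (Set.Icc 0 ((m : ℤ) + 1)))) {d : ℕ}
    (hd : d + 2 = (n + 2) * (m + 1)) {A B : T} (f : A ⟶ B)
    (hA : Supp a (Set.Icc 0 (m : ℤ)) A) (hB : Supp a (Set.Icc 0 (m : ℤ)) B) :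
    ∃ P : ComposableArrows Tᵒᵖ (d + 1), (∀ i, (Supp a (Set.Icc 0 (m : ℤ))).op (P.obj i)) ∧
      Nonempty (Arrow.mk (P.map' 0 1) ≅ Arrow.mk f.op) ∧
      IsDCokernelOn (Supp a (Set.Icc 0 (m : ℤ))).op P ∧
      ((∀ Z, Supp a (Set.Icc 0 (m : ℤ)) Z → ∀ g : B ⟶ Z, f ≫ g = 0 → g = 0) →
        IsDKernelOn (Supp a (Set.Icc 0 (m : ℤ))).op P) := by
  obtain ⟨X, hX, ⟨e⟩, hXi⟩ := ha.exists_angle_supp 𝒜 m hExt f hA hB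
  obtain ⟨Q, q, h⟩ := exists_isRightExtension_op 𝒜 hn ha m hd hA hB hX e
    fun i hi => (hXi i hi).mono fun x hx => hx.2
  have hUC : ∀ Z Y : Tᵒᵖ, (Supp a (Set.Iic (-1))).op Z → (Supp a (Set.Icc 0 (m : ℤ))).op Y →
      ∀ g : Z ⟶ Y, g = 0 := fun Z Y hZ hY g =>
    Quiver.Hom.unop_inj (ha.hom_eq_zero (fun r hr s hs => by
      have := hr.1
      simp only [Set.mem_Iic] at hs
      lia) hY hZ g.unop)
  obtain ⟨P, hP, e', hc, hk⟩ := h.exists_isDCokernelOn hUC hB hA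
  exact ⟨P, hP, e', hc, fun hf => hk fun Z hZ g hg =>
    Quiver.Hom.unop_inj (hf _ hZ g.unop (congrArg Quiver.Hom.unop hg))⟩

lemma isIdempotentComplete (ha : IsGrading S a)
    (h : ∀ j x, a j x → IdempotentsSplit x) (k : ℕ) :
    IsIdempotentComplete (Supp a (Set.Icc 0 (k : ℤ))).FullSubcategory where
  idempotents_split X e he := by
    obtain ⟨Y, i, p, hip, hpi⟩ := ha.idempotentsSplit h k X.property e.hom
      (congrArg (fun x => x.hom) he)
    exact ⟨⟨Y, X.property.of_retract i p hip⟩, ObjectProperty.homMk i, ObjectProperty.homMk p,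
      ObjectProperty.hom_ext _ hip, ObjectProperty.hom_ext _ hpi⟩

theorem isDAbelian (ha : IsGrading S a) (𝒜 : Angulation S n) (hn : 1 ≤ n) (m : ℕ)
    (hExt : IsClosedUnderNExtensions 𝒜 (Supp a (Set.Icc 0 ((m : ℤ) + 1))))
    (hIdem : ∀ j x, a j x → IdempotentsSplit x) {d : ℕ} (hd : d + 2 = (n + 2) * (m + 1)) :
    IsDAbelian (Supp a (Set.Icc 0 (m : ℤ))).FullSubcategory d where
  pos := by nlinarith
  hasFiniteBiproducts :=
    have := Supp.isClosedUnderFiniteProducts a (Set.Icc 0 (m : ℤ))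
    HasFiniteBiproducts.of_hasFiniteProducts
  isIdempotentComplete := ha.isIdempotentComplete hIdem m
  exists_dKernel {A B} f := by
    obtain ⟨P, hP, ⟨e⟩, hc, -⟩ := ha.exists_dKernelOn 𝒜 hn m hExt hd f.hom A.property B.property
    let X : ComposableArrows (Supp a (Set.Icc 0 (m : ℤ))).FullSubcategory (d + 1) :=
      (Supp a (Set.Icc 0 (m : ℤ))).lift (unopSeq P) fun i => hP _
    refine ⟨X, ?_, (isDKernelOn_ι_iff X).1 hc.unopSeq⟩
    have key : ∀ (p q : ℕ) (hp : p = 0) (hq : q = 1) (hpq : p ≤ q) (hqd : q ≤ d + 1),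
        Nonempty (Arrow.mk (P.map' p q hpq hqd).unop ≅ Arrow.mk f.hom) := by
      intro p q hp hq hpq hqd
      subst hp hq
      exact ⟨Arrow.isoMk' _ _ (Arrow.rightFunc.mapIso e).symm.unop
        (Arrow.leftFunc.mapIso e).symm.unop (congrArg Quiver.Hom.unop e.inv.w.symm)⟩
    obtain ⟨e'⟩ := key (d + 1 + 1 - (d + 1 + 1)) (d + 1 + 1 - (d + 1)) (by lia) (by lia)
      (by lia) (by lia)
    exact ⟨Arrow.isoMk' _ _ (ObjectProperty.isoMk _ (Arrow.leftFunc.mapIso e'))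
      (ObjectProperty.isoMk _ (Arrow.rightFunc.mapIso e')) (ObjectProperty.hom_ext _ e'.hom.w)⟩
  exists_dCokernel {A B} f := by
    obtain ⟨P, hP, ⟨e⟩, hc, -⟩ := ha.exists_dCokernelOn 𝒜 hn m hExt hd f.hom A.property B.property
    let X : ComposableArrows (Supp a (Set.Icc 0 (m : ℤ))).FullSubcategory (d + 1) :=
      (Supp a (Set.Icc 0 (m : ℤ))).lift P hP
    exact ⟨X, ⟨Arrow.isoMk' _ _ (ObjectProperty.isoMk _ (Arrow.leftFunc.mapIso e))
      (ObjectProperty.isoMk _ (Arrow.rightFunc.mapIso e)) (ObjectProperty.hom_ext _ e.hom.w)⟩,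
      (isDCokernelOn_ι_iff X).1 hc⟩
  dExact_of_mono X hX hc := by
    refine ⟨hc, ?_⟩
    -- `X` is an arbitrary `d`-cokernel; the constructed one, `P`, is known to be a `d`-kernel as
    -- well, and the property is transferred to `X`.
    obtain ⟨P, hP, ⟨e⟩, hc', hk⟩ := ha.exists_dCokernelOn 𝒜 hn m hExt hd (X.map' 0 1).hom
      (X.obj' 0).property (X.obj' 1).property
    have hk' := hk fun Z hZ g hg => by
      have : (ObjectProperty.homMk g : (⟨Z, hZ⟩ : ObjectProperty.FullSubcategory _) ⟶ X.obj' 0) ≫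
          X.map' 0 1 = 0 := ObjectProperty.hom_ext _ hg
      rw [← zero_comp (f := X.map' 0 1), cancel_mono] at this
      exact congrArg (fun x => x.hom) this
    rw [← isDCokernelOn_ι_iff] at hc
    rw [← isDKernelOn_ι_iff]
    exact hc.isDKernelOn_of_iso hc' hk' (fun i => (X.obj i).property) hP e.symm
  dExact_of_epi X hX hk := by
    refine ⟨?_, hk⟩
    obtain ⟨P, hP, ⟨e⟩, hc', hk'⟩ := ha.exists_dKernelOn 𝒜 hn m hExt hd (X.map' d (d + 1)).hom
      (X.obj' d).property (X.obj' (d + 1)).property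
    have hk'' := hk' fun Z hZ g hg => by
      have : X.map' d (d + 1) ≫ (ObjectProperty.homMk g :
          X.obj' (d + 1) ⟶ (⟨Z, hZ⟩ : ObjectProperty.FullSubcategory _)) = 0 :=
        ObjectProperty.hom_ext _ hg
      rw [← comp_zero (f := X.map' d (d + 1)), cancel_epi] at this
      exact congrArg (fun x => x.hom) this
    rw [← isDKernelOn_ι_iff] at hk
    rw [← isDCokernelOn_ι_iff]
    -- The same comparison, carried out in the opposite category after reversing `X`.
    refine IsDKernelOn.of_opSeq (IsDCokernelOn.isDKernelOn_of_iso hk.opSeq hc' hk''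
      (fun i => (X.obj _).property) hP ?_)
    have key : ∀ (p q : ℕ) (hp : p = d) (hq : q = d + 1) (hpq : p ≤ q) (hqd : q ≤ d + 1),
        Nonempty (Arrow.mk (X.map' p q hpq hqd).hom.op ≅ Arrow.mk (X.map' d (d + 1)).hom.op) := by
      intro p q hp hq hpq hqd
      subst hp hq
      exact ⟨Iso.refl _⟩
    exact (key (d + 1 + 1 - (1 + 1)) (d + 1 + 1 - (0 + 1)) (by lia) (by lia) (by lia)
      (by lia)).some ≪≫ e.symm

end IsGrading

end Main

end HigherAngle

end

theorem theoremD {T : Type u} [Category.{v} T] [Preadditive T] [HasFiniteBiproducts T]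
    (n : ℕ) (hn : 1 ≤ n) (S : T ≌ T) (𝒜 : HigherAngle.Angulation S n)
    (a : ℤ → ObjectProperty T)
    (ha : ∀ j, HigherAngle.IsAdditiveSubcategory (a j))
    (hHom : ∀ i j : ℤ, j ≠ i → j ≠ i + 1 → ∀ (A B : T), a i A → a j B →
      ∀ f : A ⟶ B, f = 0)
    (hSum : ∀ t : T, ∃ (i s : ℤ) (x : ℤ → T), (∀ j, a j (x j)) ∧
      Nonempty (t ≅ ⨁ fun j : Finset.Icc i s => x j))
    (hSusp : ∀ j : ℤ, a j = (a 0).map (S ^ j).functor)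
    (hIdem : IsIdempotentComplete (a 0).FullSubcategory)
    (m : ℕ)
    (hExt : HigherAngle.IsClosedUnderNExtensions 𝒜
      (HigherAngle.truncated a 0 ((m : ℤ) + 1))) :
    HigherAngle.IsDAbelian (HigherAngle.truncated a 0 (m : ℤ)).FullSubcategory
      ((n + 2) * (m + 1) - 2) := by
  have hg : HigherAngle.IsGrading S a :=
    ⟨ha, hHom, hSum, HigherAngle.succ_iff_of_eq_map S hSusp⟩
  have hsplit : ∀ j x, a j x → HigherAngle.IdempotentsSplit x := by
    intro j x hx
    rw [hSusp j] at hx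
    obtain ⟨y, hy, ⟨e⟩⟩ := hx
    refine HigherAngle.IdempotentsSplit.of_iso (HigherAngle.IdempotentsSplit.map ?_ (S ^ j)) e
    intro p hp
    obtain ⟨Y, i, q, hiq, hqi⟩ := hIdem.idempotents_split (⟨y, hy⟩ : (a 0).FullSubcategory)
      (ObjectProperty.homMk p) (ObjectProperty.hom_ext _ hp)
    exact ⟨Y.obj, i.hom, q.hom, congrArg (fun x => x.hom) hiq, congrArg (fun x => x.hom) hqi⟩
  have htr : ∀ k : ℤ, 0 ≤ k →
      HigherAngle.truncated a 0 k = HigherAngle.Supp a (Set.Icc 0 k) := fun k hk =>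
    funext fun t => propext (hg.truncated_iff hk t)
  rw [htr _ (by lia)] at hExt ⊢
  refine hg.isDAbelian 𝒜 hn m hExt hsplit ?_
  -- Ensures that the subtraction of `2` in `ℕ` is not truncated.
  have : 2 ≤ (n + 2) * (m + 1) := by nlinarith
  lia
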